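/- Let $(M,g)$ be a smooth four-dimensional Lorentzian manifold of signature $(+,-,-,-)$ with Levi-Civita connection $\nabla$ and Riemann tensor $Riem$. Let $U\subseteq M$ be open and let $(\ell,n,m,\bar m)$ be a smooth Newman–Penrose tetrad on $U$ ($\ell,n$ real, $m$ complex; the only non-zero inner products are $\ell\cdot n=1$ and $m\cdot\bar m=-1$). Set $$\kappa=\ell_{a;b}m^a\ell^b,\quad \sigma=\ell_{a;b}m^am^b,\quad \rho=\ell_{a;b}m^a\bar m^b,\quad \tau=\ell_{a;b}m^an^b,\quad \pi=-n_{a;b}\bar m^a\ell^b,$$ $$\varepsilon=\tfrac12(\ell_{a;b}n^a\ell^b-m_{a;b}\bar m^a\ell^b),\qquad \gamma=\tfrac12(\ell_{a;b}n^an^b-m_{a;b}\bar m^an^b),\qquad D=\ell^a\partial_a,\qquad \Delta=n^a\partial_a,$$ $$\Psi_2=-C_{abcd}\ell^am^b\bar m^cn^d,\qquad \Phi_{11}=\tfrac14S_{ab}(\ell^an^b+m^a\bar m^b),\qquad \Phi_{02}=\tfrac12S_{ab}m^am^b,\qquad \Phi_{20}=\overline{\Phi_{02}},$$ where $C_{abcd}$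 is the Weyl tensor and $S_{ab}=R_{ab}-\tfrac14Rg_{ab}$ the trace-free Ricci tensor (curvature convention $R_{abcd}X^aY^bZ^cW^d=g(X,(\nabla_Z\nabla_W-\nabla_W\nabla_Z-\nabla_{[Z,W]})Y)$, $R_{bd}=g^{ac}R_{abcd}$). The boost weight of a tetrad component of a covariant tensor is the number of its arguments equal to $\ell$ minus the number equal to $n$. A covariant tensor is said to be of type D (relative to the given tetrad, on $U$) if all its tetrad components of non-zero boost weight vanish on $U$ (so the zero tensor is allowed). **Theorem 5.1.** Suppose that the tetrad is a kinematic frame of a Kundt spacetime, i.e. $\kappa=\sigma=\rho=\varepsilon=0$ on $U$, and that $Riem$ and $\nabla(Riem)$ are of type D in this tetrad. Suppose that at every point of $U$ either $\Psi_2\neq0$, or $\Psi_2=0$ and $4\Phi_{11}^2-\Phi_{02}\Phi_{20}\neq0$. Then $\nabla^{(n)}(Riem)$ is of type D in this tetrad for all $n\ge2$ if and only if, on $U$, $$D\pi=0\qquad\text{and}\qquad \Delta\tau-(\gamma-\bar\gamma)\tau=0 .$$ -/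

import Mathlib

open scoped Manifold ContDiff

noncomputable section

namespace Kundt

/-- The model space of a four-dimensional manifold. -/
abbrev R4 : Type := EuclideanSpace ℝ (Fin 4)

section Geometry

variable {M : Type*} [TopologicalSpace M] [ChartedSpace R4 M] [IsManifold (𝓡 4) ∞ M]

variable (M) in
/-- (Not necessarily continuous) vector fields on `M`. -/
abbrev VField : Type _ := (x : M) → TangentSpace (𝓡 4) x

/-- The vector field `X` is smooth at the point `x`. -/
def VField.SmoothAt (X : VField M) (x : M) : Prop :=
  ContMDiffAt (𝓡 4) ((𝓡 4).prod 𝓘(ℝ, R4)) ∞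
    (fun y ↦ Bundle.TotalSpace.mk' R4 (E := fun z : M ↦ TangentSpace (𝓡 4) z) y (X y)) x

/-- The derivative `X(f)` of a vector-valued (here: real or complex) function along `X`. -/
def deriv {F : Type*} [NormedAddCommGroup F] [NormedSpace ℝ F] (X : VField M) (f : M → F) : M → F :=
  fun x ↦ mvfderiv (𝓡 4) f x (X x)

/-- The Lie bracket `[X, Y]`. -/
def bracket (X Y : VField M) : VField M := VectorField.mlieBracket (𝓡 4) X Y

variable (M) in
/-- A smooth Lorentzian metric of signature `(+,-,-,-)` on a four-dimensional manifold. -/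
structure LorentzianMetric where
  /-- The inner product on each tangent space. -/
  val : (x : M) → TangentSpace (𝓡 4) x →L[ℝ] TangentSpace (𝓡 4) x →L[ℝ] ℝ
  symm : ∀ (x : M) (v w : TangentSpace (𝓡 4) x), val x v w = val x w v
  signature : ∀ x : M, ∃ b : Module.Basis (Fin 4) ℝ (TangentSpace (𝓡 4) x),
    ∀ i j, val x (b i) (b j) = Matrix.diagonal ![(1 : ℝ), -1, -1, -1] i j
  smooth : ContMDiff (𝓡 4) ((𝓡 4).prod 𝓘(ℝ, R4 →L[ℝ] R4 →L[ℝ] ℝ)) ∞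
    (fun x ↦ Bundle.TotalSpace.mk' (R4 →L[ℝ] R4 →L[ℝ] ℝ)
      (E := fun z : M ↦ TangentSpace (𝓡 4) z →L[ℝ] TangentSpace (𝓡 4) z →L[ℝ] ℝ) x (val x))

variable (M) in
/-- Covariant tensor fields of rank `k`, as functions of `k` vector fields. -/
abbrev CovTensor (k : ℕ) : Type _ := (Fin k → VField M) → M → ℝ

namespace LorentzianMetric

variable (g : LorentzianMetric M)

/-- The function `g(X, Y)`. -/
def ip (X Y : VField M) : M → ℝ := fun x ↦ g.val x (X x) (Y x)

/-- The right-hand side of the Koszul formula for `2 g(∇_X Y, W)`. -/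
def koszul (X Y W : VField M) : M → ℝ := fun x ↦
  deriv X (g.ip Y W) x + deriv Y (g.ip X W) x - deriv W (g.ip X Y) x
    + g.ip (bracket X Y) W x - g.ip (bracket X W) Y x - g.ip (bracket Y W) X x

/-- The Levi-Civita connection: for `X`, `Y` smooth near `x`, the vector `(∇_X Y)(x)` is the unique
vector `v` such that `2 g(v, W) = koszul X Y W` at `x` for every vector field `W` smooth at `x`. -/
def nablaV (X Y : VField M) : VField M := fun x ↦
  Classical.epsilon fun v : TangentSpace (𝓡 4) x ↦
    ∀ W : VField M, W.SmoothAt x → 2 * g.val x v (W x) = g.koszul X Y W x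

/-- The curvature `R(X,Y)Z = ∇_X ∇_Y Z - ∇_Y ∇_X Z - ∇_[X,Y] Z`. -/
def curvature (X Y Z : VField M) : VField M :=
  g.nablaV X (g.nablaV Y Z) - g.nablaV Y (g.nablaV X Z) - g.nablaV (bracket X Y) Z

/-- The Riemann tensor `R_{abcd} X^a Y^b Z^c W^d = g(X, R(Z,W)Y)`. -/
def riem : CovTensor M 4 := fun V ↦ g.ip (V 0) (g.curvature (V 2) (V 3) (V 1))

/-- The covariant derivative of a covariant tensor field,
`(∇T)(X, Y₁, …, Y_k) = X(T(Y₁, …, Y_k)) - ∑ᵢ T(Y₁, …, ∇_X Yᵢ, …, Y_k)`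
(the differentiation slot is put first). -/
def nabla {k : ℕ} (T : CovTensor M k) : CovTensor M (k + 1) := fun V x ↦
  deriv (V 0) (T (Fin.tail V)) x
    - ∑ i : Fin k, T (Function.update (Fin.tail V) i (g.nablaV (V 0) (Fin.tail V i))) x

/-- The `n`-th covariant derivative `∇⁽ⁿ⁾(Riem)` of the Riemann tensor. -/
def nablaRiem : (n : ℕ) → CovTensor M (4 + n)
  | 0 => g.riem
  | n + 1 => g.nabla (nablaRiem n)

end LorentzianMetric

/-- A (smooth) Newman-Penrose tetrad `(ℓ, n, m, m̄)` on `U`, where `m = (m₁ + i m₂)/√2`: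
the only non-zero inner products are `ℓ·n = 1` and `m·m̄ = -1`. -/
structure NPTetrad (g : LorentzianMetric M) (U : Set M) where
  l : VField M
  n : VField M
  m₁ : VField M
  m₂ : VField M
  smooth_l : ∀ x ∈ U, l.SmoothAt x
  smooth_n : ∀ x ∈ U, n.SmoothAt x
  smooth_m₁ : ∀ x ∈ U, m₁.SmoothAt x
  smooth_m₂ : ∀ x ∈ U, m₂.SmoothAt x
  l_l : ∀ x ∈ U, g.ip l l x = 0
  l_n : ∀ x ∈ U, g.ip l n x = 1
  l_m₁ : ∀ x ∈ U, g.ip l m₁ x = 0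
  l_m₂ : ∀ x ∈ U, g.ip l m₂ x = 0
  n_n : ∀ x ∈ U, g.ip n n x = 0
  n_m₁ : ∀ x ∈ U, g.ip n m₁ x = 0
  n_m₂ : ∀ x ∈ U, g.ip n m₂ x = 0
  m₁_m₁ : ∀ x ∈ U, g.ip m₁ m₁ x = -1
  m₁_m₂ : ∀ x ∈ U, g.ip m₁ m₂ x = 0
  m₂_m₂ : ∀ x ∈ U, g.ip m₂ m₂ x = -1

namespace NPTetrad

variable {g : LorentzianMetric M} {U : Set M} (e : NPTetrad g U)

/-- The real null frame `(ℓ, n, m₁, m₂)` underlying the tetrad. -/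
def frame : Fin 4 → VField M := ![e.l, e.n, e.m₁, e.m₂]

/-- The coefficients of `ℓ`, `n`, `m`, `m̄` in the real null frame. -/
def cl : Fin 4 → ℂ := ![1, 0, 0, 0]
/-- See `cl`. -/
def cn : Fin 4 → ℂ := ![0, 1, 0, 0]
/-- See `cl`. -/
def cm : Fin 4 → ℂ := ![0, 0, 1 / (Real.sqrt 2 : ℂ), Complex.I / (Real.sqrt 2 : ℂ)]
/-- See `cl`. -/
def cmb : Fin 4 → ℂ :=
  ![0, 0, 1 / (Real.sqrt 2 : ℂ), -Complex.I / (Real.sqrt 2 : ℂ)]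

/-- Complex-linear extension of real frame components to complex combinations of the frame. -/
def ext₂ (F : Fin 4 → Fin 4 → ℝ) (u v : Fin 4 → ℂ) : ℂ :=
  ∑ a, ∑ b, u a * v b * (F a b : ℂ)
/-- See `ext₂`. -/
def ext₃ (F : Fin 4 → Fin 4 → Fin 4 → ℝ) (u v w : Fin 4 → ℂ) : ℂ :=
  ∑ a, ∑ b, ∑ c, u a * v b * w c * (F a b c : ℂ)
/-- See `ext₂`. -/
def ext₄ (F : Fin 4 → Fin 4 → Fin 4 → Fin 4 → ℝ) (u v w z : Fin 4 → ℂ) : ℂ :=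
  ∑ a, ∑ b, ∑ c, ∑ d, u a * v b * w c * z d * (F a b c d : ℂ)

/-- `conn x a b c = u_{i;j} v^i w^j` at `x` for `u`, `v`, `w` the frame vectors number
`a`, `b`, `c`, that is, `g(∇_w u, v)`. -/
def conn (x : M) (a b c : Fin 4) : ℝ :=
  g.ip (g.nablaV (e.frame c) (e.frame a)) (e.frame b) x

/-- `κ = ℓ_{a;b} m^a ℓ^b`. -/
def κ (x : M) : ℂ := ext₃ (e.conn x) cl cm cl

/-- `ρ = ℓ_{a;b} m^a m̄^b`. -/
def ρ (x : M) : ℂ := ext₃ (e.conn x) cl cm cmb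

/-- `σ = ℓ_{a;b} m^a m^b`. -/
def σ (x : M) : ℂ := ext₃ (e.conn x) cl cm cm

/-- `τ = ℓ_{a;b} m^a n^b`. -/
def τ (x : M) : ℂ := ext₃ (e.conn x) cl cm cn

/-- `π = - n_{a;b} m̄^a ℓ^b`. -/
def π (x : M) : ℂ := -ext₃ (e.conn x) cn cmb cl

/-- `ε = (ℓ_{a;b} n^a ℓ^b - m_{a;b} m̄^a ℓ^b) / 2`. -/
def ε (x : M) : ℂ := (ext₃ (e.conn x) cl cn cl - ext₃ (e.conn x) cm cmb cl) / 2

/-- `γ = (ℓ_{a;b} n^a n^b - m_{a;b} m̄^a n^b) / 2`. -/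
def γ (x : M) : ℂ := (ext₃ (e.conn x) cl cn cn - ext₃ (e.conn x) cm cmb cn) / 2

/-- Frame components `g_{ab}` of the metric. -/
def metricC (x : M) (a b : Fin 4) : ℝ := g.ip (e.frame a) (e.frame b) x

/-- Frame components `R_{abcd}` of the Riemann tensor. -/
def riemC (x : M) (a b c d : Fin 4) : ℝ :=
  g.riem ![e.frame a, e.frame b, e.frame c, e.frame d] x

/-- Frame components of the Ricci tensor `R_{bd} = g^{ac} R_{abcd}`,
with `g^{ac} = ℓ^a n^c + n^a ℓ^c - m₁^a m₁^c - m₂^a m₂^c`. -/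
def ricciC (x : M) (b d : Fin 4) : ℝ :=
  e.riemC x 0 b 1 d + e.riemC x 1 b 0 d - e.riemC x 2 b 2 d - e.riemC x 3 b 3 d

/-- The Ricci scalar `R = g^{ab} R_{ab}`. -/
def scalarR (x : M) : ℝ :=
  e.ricciC x 0 1 + e.ricciC x 1 0 - e.ricciC x 2 2 - e.ricciC x 3 3

/-- Frame components of the trace-free Ricci tensor `S_{ab} = R_{ab} - R g_{ab} / 4`. -/
def tracefreeRicciC (x : M) (a b : Fin 4) : ℝ :=
  e.ricciC x a b - e.scalarR x / 4 * e.metricC x a b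

/-- Frame components of the Weyl tensor. -/
def weylC (x : M) (a b c d : Fin 4) : ℝ :=
  e.riemC x a b c d
    - (e.metricC x a c * e.ricciC x b d - e.metricC x a d * e.ricciC x b c
      - e.metricC x b c * e.ricciC x a d + e.metricC x b d * e.ricciC x a c) / 2
    + e.scalarR x / 6 * (e.metricC x a c * e.metricC x b d - e.metricC x a d * e.metricC x b c)

/-- `Ψ₂ = - C_{abcd} ℓ^a m^b m̄^c n^d`. -/
def Ψ₂ (x : M) : ℂ := -ext₄ (e.weylC x) cl cm cmb cn

/-- `Φ₁₁ = S_{ab} (ℓ^a n^b + m^a m̄^b) / 4`. -/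
def Φ₁₁ (x : M) : ℂ :=
  (ext₂ (e.tracefreeRicciC x) cl cn + ext₂ (e.tracefreeRicciC x) cm cmb) / 4

/-- `Φ₀₂ = S_{ab} m^a m^b / 2`. -/
def Φ₀₂ (x : M) : ℂ := ext₂ (e.tracefreeRicciC x) cm cm / 2

/-- `Φ₂₀ = S_{ab} m̄^a m̄^b / 2`. -/
def Φ₂₀ (x : M) : ℂ := ext₂ (e.tracefreeRicciC x) cmb cmb / 2

/-- The directional derivative `D = ℓ^a ∂_a` of a complex function. -/
def D (f : M → ℂ) : M → ℂ := deriv e.l f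

/-- The directional derivative `Δ = n^a ∂_a` of a complex function. -/
def Δ (f : M → ℂ) : M → ℂ := deriv e.n f

/-- The tetrad is a kinematic frame of a Kundt spacetime: `ℓ` is geodesic, shear-free,
expansion-free and twist-free, and the frame is scaled so that `ε = 0`. -/
def IsKinematic : Prop := ∀ x ∈ U, e.κ x = 0 ∧ e.σ x = 0 ∧ e.ρ x = 0 ∧ e.ε x = 0

end NPTetrad

/-- Boost weight of a frame component: each `ℓ` (index `0`) counts `+1`, each `n` (index `1`)
counts `-1`, and the transverse vectors (indices `2`, `3`, equivalently `m`, `m̄`) count `0`. -/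
def boostWeight {k : ℕ} (I : Fin k → Fin 4) : ℤ := ∑ j, (![1, -1, 0, 0] : Fin 4 → ℤ) (I j)

/-- The tensor `T` is of type D in the tetrad `e`: all its components of non-zero boost weight
vanish on `U`. -/
def NPTetrad.IsTypeD {g : LorentzianMetric M} {U : Set M} (e : NPTetrad g U) {k : ℕ}
    (T : CovTensor M k) : Prop :=
  ∀ I : Fin k → Fin 4, boostWeight I ≠ 0 → ∀ x ∈ U, T (fun j ↦ e.frame (I j)) x = 0

end Geometry

end Kundt

end

/-! ### Calculus of smooth functions and vector fields at a point. -/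

noncomputable section
namespace Kundt

variable {M : Type*} [TopologicalSpace M] [ChartedSpace R4 M]

/-! Everything is graded by boost weight. In a null frame the connection matrices `Γ c` are
infinitesimal Lorentz transformations, and each splits into a part of degree +1 (`raise`, a null
rotation), of degree 0 (`spin`, a boost and a rotation) and of degree -1 (`lower`, the opposite null
rotation). On components, ∇ is a frame derivative minus the action `act (Γ c)`, and a type D tensor
has only components of weight 0.

The kinematic conditions remove the `lower` part of every `Γ c` except `Γ 1`, and the `spin` part of
`Γ 0`. For c ≠ 0, the vanishing of suitable components of ∇Riem says that the `raise` part of `Γ c`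
annihilates Riem. The condition on Ψ₂ and the Φ's forbids this for a nonzero null rotation
(`nondegenerate_riemC`, `raise_eq_zero`, `lower_eq_zero`), so that part vanishes as well. The
outcome is `IsReduced`: `Γ 0` is purely raising with parameter π, `Γ 1` is a spin plus a lowering
part with parameter τ, and `Γ 2`, `Γ 3` are spins.

Now let T and ∇T be type D. The Ricci identity, whose curvature term respects the grading, lets the
two derivative slots of ∇∇T be exchanged. Only two families of components of nonzero weight survive
this: two slots ℓ against weight -1, and two slots n against weight 1. They equal minus the action
on T of the null rotation with parameter Dπ, respectively Δτ - (γ - γ̄)τ (`comp_zero_zero`,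
`comp_one_one`). If both parameters vanish, type D propagates from ∇ⁿ and ∇ⁿ⁺¹ to ∇ⁿ⁺². Conversely,
if ∇∇Riem is type D, both null rotations annihilate Riem, and nondegeneracy forces the parameters to
be zero. -/

lemma two_le_infty : (2 : ℕ∞ω) ≤ ∞ := WithTop.coe_le_coe.2 (le_top : (2 : ℕ∞) ≤ ⊤)

lemma three_le_infty : (3 : ℕ∞ω) ≤ ∞ := WithTop.coe_le_coe.2 (le_top : (3 : ℕ∞) ≤ ⊤)

/-- Smoothness of a vector-valued function at a point. -/
def FSmoothAt {F : Type*} [NormedAddCommGroup F] [NormedSpace ℝ F] (f : M → F) (x : M) : Prop :=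
  ContMDiffAt (𝓡 4) 𝓘(ℝ, F) ∞ f x

namespace FSmoothAt

variable {f h : M → ℝ} {x : M}

lemma mdiff {F : Type*} [NormedAddCommGroup F] [NormedSpace ℝ F] {f : M → F}
    (hf : FSmoothAt f x) : MDifferentiableAt (𝓡 4) 𝓘(ℝ, F) f x :=
  ContMDiffAt.mdifferentiableAt hf (by simp)

lemma add (hf : FSmoothAt f x) (hh : FSmoothAt h x) : FSmoothAt (fun y ↦ f y + h y) x :=
  ContMDiffAt.add hf hh

lemma sub (hf : FSmoothAt f x) (hh : FSmoothAt h x) : FSmoothAt (fun y ↦ f y - h y) x :=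
  ContMDiffAt.sub hf hh

lemma neg (hf : FSmoothAt f x) : FSmoothAt (fun y ↦ - f y) x :=
  ContMDiffAt.neg hf

lemma mul (hf : FSmoothAt f x) (hh : FSmoothAt h x) : FSmoothAt (fun y ↦ f y * h y) x :=
  ContMDiffAt.mul hf hh

lemma const (c : ℝ) : FSmoothAt (fun _ : M ↦ c) x := contMDiffAt_const

lemma sum {ι : Type*} {s : Finset ι} {f : ι → M → ℝ} (hf : ∀ i ∈ s, FSmoothAt (f i) x) :
    FSmoothAt (fun y ↦ ∑ i ∈ s, f i y) x :=
  ContMDiffAt.sum hf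

lemma congr_of_eventuallyEq (hf : FSmoothAt f x) (h' : h =ᶠ[nhds x] f) : FSmoothAt h x :=
  ContMDiffAt.congr_of_eventuallyEq hf h'

end FSmoothAt

section deriv

variable {f h : M → ℝ} {x : M} (X Y : VField M)

lemma deriv_add (hf : FSmoothAt f x) (hh : FSmoothAt h x) :
    deriv X (fun y ↦ f y + h y) x = deriv X f x + deriv X h x := by
  simp [deriv, mvfderiv_fun_add hf.mdiff hh.mdiff]

lemma deriv_sub (hf : FSmoothAt f x) (hh : FSmoothAt h x) :
    deriv X (fun y ↦ f y - h y) x = deriv X f x - deriv X h x := by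
  simp [deriv, mvfderiv_fun_sub hf.mdiff hh.mdiff]

lemma deriv_neg : deriv X (fun y ↦ - f y) x = - deriv X f x := by
  simp [deriv, mvfderiv_fun_neg]

lemma deriv_mul (hf : FSmoothAt f x) (hh : FSmoothAt h x) :
    deriv X (fun y ↦ f y * h y) x = deriv X f x * h x + f x * deriv X h x := by
  simp [deriv, mvfderiv_fun_mul hf.mdiff hh.mdiff]; ring

lemma deriv_const {F : Type*} [NormedAddCommGroup F] [NormedSpace ℝ F] (c : F) :
    deriv X (fun _ : M ↦ c) x = 0 := by
  simp [deriv, mvfderiv_const]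

lemma deriv_congr {F : Type*} [NormedAddCommGroup F] [NormedSpace ℝ F] {f h : M → F}
    (hfh : f =ᶠ[nhds x] h) : deriv X f x = deriv X h x := by
  have h1 := hfh.mfderiv_eq (I := 𝓡 4) (I' := 𝓘(ℝ, F))
  have h2 := hfh.self_of_nhds
  simp only [deriv, mvfderiv, ContinuousLinearMap.comp_apply]
  rw [h1]
  rfl

lemma deriv_eq_zero_of_eventually {F : Type*} [NormedAddCommGroup F] [NormedSpace ℝ F] {f : M → F}
    (hf : ∀ᶠ y in nhds x, f y = 0) : deriv X f x = 0 := by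
  rw [deriv_congr X (h := fun _ ↦ (0 : F)) hf, deriv_const]

lemma deriv_sum {ι : Type*} {s : Finset ι} {f : ι → M → ℝ} (hf : ∀ i ∈ s, FSmoothAt (f i) x) :
    deriv X (fun y ↦ ∑ i ∈ s, f i y) x = ∑ i ∈ s, deriv X (f i) x := by
  classical
  induction s using Finset.induction_on with
  | empty => simp [deriv_const]
  | insert a s ha ih =>
    simp only [Finset.sum_insert ha]
    rw [deriv_add X (hf a (Finset.mem_insert_self _ _))
      (FSmoothAt.sum fun i hi ↦ hf i (Finset.mem_insert_of_mem hi)),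
      ih fun i hi ↦ hf i (Finset.mem_insert_of_mem hi)]

lemma deriv_dir_add {f : M → ℝ} : deriv (X + Y) f x = deriv X f x + deriv Y f x := by
  simp [deriv]

lemma deriv_dir_congr {X Y : VField M} {f : M → ℝ} (h : X x = Y x) :
    deriv X f x = deriv Y f x := by
  simp [deriv, h]

lemma deriv_dir_smul (c : M → ℝ) {f : M → ℝ} :
    deriv (fun y ↦ c y • X y) f x = c x * deriv X f x := by
  simp [deriv]

lemma deriv_dir_sum {ι : Type*} {s : Finset ι} (X : ι → VField M) {f : M → ℝ} :
    deriv (fun y ↦ ∑ i ∈ s, X i y) f x = ∑ i ∈ s, deriv (X i) f x := by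
  simp [deriv]

/-- Derivatives of complex linear combinations of real functions. -/
lemma deriv_ofReal_comb {a b : ℂ} (hf : FSmoothAt f x) (hh : FSmoothAt h x) :
    deriv X (fun y ↦ a * (f y : ℂ) + b * (h y : ℂ)) x
      = a * ((deriv X f x : ℝ) : ℂ) + b * ((deriv X h x : ℝ) : ℂ) := by
  have hL : ∀ (c : ℂ) (u : M → ℝ), MDifferentiableAt (𝓡 4) 𝓘(ℝ, ℝ) u x →
      HasMFDerivAt (𝓡 4) 𝓘(ℝ, ℂ) (fun y ↦ c * (u y : ℂ)) x
        ((((ContinuousLinearMap.mul ℝ ℂ c).comp Complex.ofRealCLM) : ℝ →L[ℝ] ℂ).comp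
          (mfderiv (𝓡 4) 𝓘(ℝ, ℝ) u x)) := by
    intro c u hu
    exact (((ContinuousLinearMap.mul ℝ ℂ c).comp Complex.ofRealCLM :
      ℝ →L[ℝ] ℂ).hasMFDerivAt).comp x hu.hasMFDerivAt
  have h1 := (hL a f hf.mdiff).add (hL b h hh.mdiff)
  have h2 := h1.mfderiv
  simp only [deriv, mvfderiv, ContinuousLinearMap.comp_apply]
  have h3 : ((fun y ↦ a * (f y : ℂ)) + fun y ↦ b * (h y : ℂ))
    = fun y ↦ a * (f y : ℂ) + b * (h y : ℂ) := rfl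
  rw [h3] at h2
  rw [h2]
  rfl

end deriv

section fields

variable {f h : M → ℝ} {x : M} {X Y Z : VField M}

namespace VField.SmoothAt

variable [IsManifold (𝓡 4) ∞ M]

lemma mdiff (hX : X.SmoothAt x) : MDifferentiableAt (𝓡 4) ((𝓡 4).prod 𝓘(ℝ, R4))
    (fun y ↦ (X y : TangentBundle (𝓡 4) M)) x :=
  ContMDiffAt.mdifferentiableAt hX (by simp)

lemma add (hX : X.SmoothAt x) (hY : Y.SmoothAt x) : VField.SmoothAt (X + Y) x :=
  ContMDiffAt.add_section hX hY

lemma sub (hX : X.SmoothAt x) (hY : Y.SmoothAt x) : VField.SmoothAt (X - Y) x :=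
  ContMDiffAt.sub_section hX hY

lemma smul (hf : FSmoothAt f x) (hX : X.SmoothAt x) : VField.SmoothAt (fun y ↦ f y • X y) x :=
  ContMDiffAt.smul_section hf hX

lemma sum {ι : Type*} {s : Finset ι} {X : ι → VField M} (hX : ∀ i ∈ s, (X i).SmoothAt x) :
    VField.SmoothAt (fun y ↦ ∑ i ∈ s, X i y) x :=
  ContMDiffAt.sum_section hX

lemma congr_of_eventuallyEq (hX : X.SmoothAt x) (h : Y =ᶠ[nhds x] X) : Y.SmoothAt x := by
  refine ContMDiffAt.congr_of_eventuallyEq hX ?_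
  filter_upwards [h] with y hy
  rw [hy]

lemma bracket (hX : X.SmoothAt x) (hY : Y.SmoothAt x) : (Kundt.bracket X Y).SmoothAt x := by
  have : IsManifold (𝓡 4) (((⊤ : ℕ∞) : ℕ∞ω) + 1) M := ‹IsManifold (𝓡 4) ∞ M›
  have : IsManifold (𝓡 4) (minSmoothness ℝ 2) M :=
    .of_le (n := ∞) (by simpa using two_le_infty)
  exact ContMDiffAt.mlieBracket_vectorField (m := ⊤) (n := ⊤) hX hY (by simp)

end VField.SmoothAt

lemma bracket_swap_apply : bracket X Y x = - bracket Y X x :=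
  VectorField.mlieBracket_swap_apply

lemma bracket_congr {X' Y' : VField M} (hX : X =ᶠ[nhds x] X') (hY : Y =ᶠ[nhds x] Y') :
    bracket X Y x = bracket X' Y' x :=
  hX.mlieBracket_vectorField_eq hY

variable [IsManifold (𝓡 4) ∞ M]

lemma bracket_add_right (hY : Y.SmoothAt x) (hZ : Z.SmoothAt x) :
    bracket X (Y + Z) x = bracket X Y x + bracket X Z x := by
  have : IsManifold (𝓡 4) 2 M := .of_le (n := ∞) two_le_infty
  exact VectorField.mlieBracket_add_right hY.mdiff hZ.mdiff

lemma bracket_smul_right (hf : FSmoothAt f x) (hY : Y.SmoothAt x) :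
    bracket X (fun y ↦ f y • Y y) x = deriv X f x • Y x + f x • bracket X Y x := by
  have : IsManifold (𝓡 4) 2 M := .of_le (n := ∞) two_le_infty
  exact VectorField.mlieBracket_smul_right hf.mdiff hY.mdiff

lemma jacobi (hX : X.SmoothAt x) (hY : Y.SmoothAt x) (hZ : Z.SmoothAt x) :
    bracket X (bracket Y Z) x = bracket (bracket X Y) Z x + bracket Y (bracket X Z) x := by
  have : IsManifold (𝓡 4) (minSmoothness ℝ 3) M :=
    .of_le (n := ∞) (by simpa using three_le_infty)
  refine VectorField.leibniz_identity_mlieBracket_apply ?_ ?_ ?_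
  · exact ContMDiffAt.of_le hX (by simpa using two_le_infty)
  · exact ContMDiffAt.of_le hY (by simpa using two_le_infty)
  · exact ContMDiffAt.of_le hZ (by simpa using two_le_infty)

end fields

end Kundt
end

/-! ### Smoothness on open sets, the Koszul form, and expansion in the null frame. -/

noncomputable section
namespace Kundt

variable {M : Type*} [TopologicalSpace M] [ChartedSpace R4 M]

/-- Smoothness of a real function on a set. -/
def FSmoothOn (U : Set M) (f : M → ℝ) : Prop := ∀ x ∈ U, FSmoothAt f x

section on

variable {U : Set M} {f h : M → ℝ}

lemma FSmoothOn.add (hf : FSmoothOn U f) (hh : FSmoothOn U h) : FSmoothOn U (fun y ↦ f y + h y) :=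
  fun x hx ↦ (hf x hx).add (hh x hx)

lemma FSmoothOn.sub (hf : FSmoothOn U f) (hh : FSmoothOn U h) : FSmoothOn U (fun y ↦ f y - h y) :=
  fun x hx ↦ (hf x hx).sub (hh x hx)

lemma FSmoothOn.mul (hf : FSmoothOn U f) (hh : FSmoothOn U h) : FSmoothOn U (fun y ↦ f y * h y) :=
  fun x hx ↦ (hf x hx).mul (hh x hx)

lemma FSmoothOn.neg (hf : FSmoothOn U f) : FSmoothOn U (fun y ↦ - f y) :=
  fun x hx ↦ (hf x hx).neg

lemma FSmoothOn.const (c : ℝ) : FSmoothOn U (fun _ ↦ c) := fun _ _ ↦ FSmoothAt.const c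

lemma FSmoothOn.sum {ι : Type*} {s : Finset ι} {f : ι → M → ℝ}
    (hf : ∀ i ∈ s, FSmoothOn U (f i)) : FSmoothOn U (fun y ↦ ∑ i ∈ s, f i y) :=
  fun x hx ↦ FSmoothAt.sum fun i hi ↦ hf i hi x hx

lemma FSmoothOn.congr (hU : IsOpen U) (hf : FSmoothOn U f) (hfh : ∀ x ∈ U, h x = f x) :
    FSmoothOn U h :=
  fun x hx ↦ (hf x hx).congr_of_eventuallyEq (Filter.eventuallyEq_of_mem (hU.mem_nhds hx) hfh)

lemma deriv_congr_on (hU : IsOpen U) {x : M} (hx : x ∈ U) (X : VField M)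
    (hfh : ∀ y ∈ U, f y = h y) : deriv X f x = deriv X h x :=
  deriv_congr X (Filter.eventuallyEq_of_mem (hU.mem_nhds hx) hfh)

variable [IsManifold (𝓡 4) ∞ M]

/-- Smoothness of a vector field on a set. -/
def VField.SmoothOn (U : Set M) (X : VField M) : Prop := ∀ x ∈ U, X.SmoothAt x

variable {X Y : VField M}

lemma VField.SmoothOn.add (hX : X.SmoothOn U) (hY : Y.SmoothOn U) : VField.SmoothOn U (X + Y) :=
  fun x hx ↦ (hX x hx).add (hY x hx)

lemma VField.SmoothOn.sub (hX : X.SmoothOn U) (hY : Y.SmoothOn U) : VField.SmoothOn U (X - Y) :=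
  fun x hx ↦ (hX x hx).sub (hY x hx)

lemma VField.SmoothOn.smul (hf : FSmoothOn U f) (hX : X.SmoothOn U) :
    VField.SmoothOn U (fun y ↦ f y • X y) :=
  fun x hx ↦ (hX x hx).smul (hf x hx)

lemma VField.SmoothOn.sum {ι : Type*} {s : Finset ι} {X : ι → VField M}
    (hX : ∀ i ∈ s, (X i).SmoothOn U) : VField.SmoothOn U (fun y ↦ ∑ i ∈ s, X i y) :=
  fun x hx ↦ VField.SmoothAt.sum fun i hi ↦ hX i hi x hx

lemma VField.SmoothOn.bracket (hX : X.SmoothOn U) (hY : Y.SmoothOn U) :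
    (Kundt.bracket X Y).SmoothOn U :=
  fun x hx ↦ (hX x hx).bracket (hY x hx)

lemma VField.SmoothOn.congr (hU : IsOpen U) (hX : X.SmoothOn U) (hXY : ∀ x ∈ U, Y x = X x) :
    Y.SmoothOn U :=
  fun x hx ↦ (hX x hx).congr_of_eventuallyEq (Filter.eventuallyEq_of_mem (hU.mem_nhds hx) hXY)

end on

variable [IsManifold (𝓡 4) ∞ M]

namespace LorentzianMetric

variable (g : LorentzianMetric M) {x : M} {X Y Z W : VField M} {f : M → ℝ}

lemma ip_comm (X Y : VField M) : g.ip X Y = g.ip Y X := funext fun x ↦ g.symm x _ _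

lemma ip_add_left (X Y Z : VField M) (x : M) : g.ip (X + Y) Z x = g.ip X Z x + g.ip Y Z x := by
  simp [ip]

lemma ip_add_right (X Y Z : VField M) (x : M) : g.ip X (Y + Z) x = g.ip X Y x + g.ip X Z x := by
  simp [ip]

lemma ip_smul_left (X Z : VField M) (x : M) : g.ip (fun y ↦ f y • X y) Z x = f x * g.ip X Z x := by
  simp [ip]

lemma ip_smul_right (X Z : VField M) (x : M) :
    g.ip X (fun y ↦ f y • Z y) x = f x * g.ip X Z x := by
  simp [ip]

lemma ip_smooth (hX : X.SmoothAt x) (hY : Y.SmoothAt x) : FSmoothAt (g.ip X Y) x := by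
  have h1 := ContMDiffAt.clm_bundle_apply₂ (F₃ := ℝ) (E₃ := Bundle.Trivial M ℝ)
    (b := fun y : M ↦ y) (g.smooth x) hX hY
  exact (Bundle.contMDiffAt_section x).1 h1

lemma koszul_congr {X X' Y Y' W W' : VField M} (hX : X =ᶠ[nhds x] X')
    (hY : Y =ᶠ[nhds x] Y') (hW : W =ᶠ[nhds x] W') :
    g.koszul X Y W x = g.koszul X' Y' W' x := by
  have ip_congr : ∀ {A A' B B' : VField M}, A =ᶠ[nhds x] A' → B =ᶠ[nhds x] B' →
      g.ip A B =ᶠ[nhds x] g.ip A' B' := by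
    intro A A' B B' hA hB
    filter_upwards [hA, hB] with y h1 h2
    simp [ip, h1, h2]
  simp only [koszul]
  rw [deriv_congr X (ip_congr hY hW), deriv_congr Y (ip_congr hX hW),
    deriv_congr W (ip_congr hX hY), deriv_dir_congr hX.self_of_nhds, deriv_dir_congr hY.self_of_nhds,
    deriv_dir_congr hW.self_of_nhds]
  simp only [ip, bracket_congr hX hY, bracket_congr hX hW, bracket_congr hY hW, hX.self_of_nhds,
    hY.self_of_nhds, hW.self_of_nhds]

lemma koszul_add_right (hX : X.SmoothAt x) (hY : Y.SmoothAt x) (hZ : Z.SmoothAt x)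
    (hW : W.SmoothAt x) : g.koszul X Y (Z + W) x = g.koszul X Y Z x + g.koszul X Y W x := by
  have h1 : ∀ A : VField M, g.ip A (Z + W) = fun y ↦ g.ip A Z y + g.ip A W y :=
    fun A ↦ funext fun y ↦ g.ip_add_right _ _ _ _
  have hb1 := bracket_add_right (X := X) hZ hW
  have hb2 := bracket_add_right (X := Y) hZ hW
  simp only [koszul, h1]
  rw [deriv_add X (g.ip_smooth hY hZ) (g.ip_smooth hY hW),
    deriv_add Y (g.ip_smooth hX hZ) (g.ip_smooth hX hW), deriv_dir_add]
  simp only [ip, hb1, hb2, map_add, add_apply]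
  ring

/-- The terms with X(f) and Y(f) coming from the derivatives cancel those coming from the brackets
with W. This linearity over functions is what makes the Koszul form represent a vector. -/
lemma koszul_smul_right (hX : X.SmoothAt x) (hY : Y.SmoothAt x) (hf : FSmoothAt f x)
    (hW : W.SmoothAt x) : g.koszul X Y (fun y ↦ f y • W y) x = f x * g.koszul X Y W x := by
  have h1 : ∀ A : VField M, g.ip A (fun y ↦ f y • W y) = fun y ↦ f y * g.ip A W y :=
    fun A ↦ funext fun y ↦ g.ip_smul_right _ _ _
  have hb1 := bracket_smul_right (X := X) hf hW
  have hb2 := bracket_smul_right (X := Y) hf hW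
  simp only [koszul, h1]
  rw [deriv_mul X hf (g.ip_smooth hY hW), deriv_mul Y hf (g.ip_smooth hX hW), deriv_dir_smul]
  simp only [ip, hb1, hb2, map_add, map_smul, add_apply,
    smul_apply, smul_eq_mul]
  rw [g.symm x (W x) (Y x), g.symm x (W x) (X x)]
  ring

lemma koszul_sum_right {ι : Type*} {s : Finset ι} {W : ι → VField M}
    (hX : X.SmoothAt x) (hY : Y.SmoothAt x) (hW : ∀ i ∈ s, (W i).SmoothAt x) :
    g.koszul X Y (fun y ↦ ∑ i ∈ s, W i y) x = ∑ i ∈ s, g.koszul X Y (W i) x := by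
  classical
  induction s using Finset.induction_on with
  | empty =>
    have := g.koszul_smul_right (f := fun _ ↦ 0) (W := X) hX hY (FSmoothAt.const 0) hX
    simpa using this
  | insert a s ha ih =>
    simp only [Finset.sum_insert ha]
    have := g.koszul_add_right hX hY (hW a (Finset.mem_insert_self _ _))
      (VField.SmoothAt.sum fun i hi ↦ hW i (Finset.mem_insert_of_mem hi))
    rw [← ih fun i hi ↦ hW i (Finset.mem_insert_of_mem hi), ← this]
    rfl

end LorentzianMetric

namespace NPTetrad

variable {g : LorentzianMetric M} {U : Set M} (e : NPTetrad g U) {x : M}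

/-- The index of the frame vector dual to a given one (up to sign). -/
def dual : Fin 4 → Fin 4 := ![1, 0, 2, 3]

/-- The sign in the pairing of a frame vector with its dual. -/
def sgn : Fin 4 → ℝ := ![1, 1, -1, -1]

lemma dual_dual (a : Fin 4) : dual (dual a) = a := by fin_cases a <;> rfl

lemma sgn_dual (a : Fin 4) : sgn (dual a) = sgn a := by fin_cases a <;> rfl

lemma sgn_mul_self (a : Fin 4) : sgn a * sgn a = 1 := by fin_cases a <;> simp [sgn]

lemma ip_frame (hx : x ∈ U) (a b : Fin 4) :
    g.ip (e.frame a) (e.frame b) x = if b = dual a then sgn a else 0 := by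
  have h1 := e.l_l x hx; have h2 := e.l_n x hx; have h3 := e.l_m₁ x hx; have h4 := e.l_m₂ x hx
  have h5 := e.n_n x hx; have h6 := e.n_m₁ x hx; have h7 := e.n_m₂ x hx
  have h8 := e.m₁_m₁ x hx; have h9 := e.m₁_m₂ x hx; have h10 := e.m₂_m₂ x hx
  have k2 := g.ip_comm e.n e.l; have k3 := g.ip_comm e.m₁ e.l; have k4 := g.ip_comm e.m₂ e.l
  have k6 := g.ip_comm e.m₁ e.n; have k7 := g.ip_comm e.m₂ e.n; have k9 := g.ip_comm e.m₂ e.m₁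
  fin_cases a <;> fin_cases b <;> simp [frame, dual, sgn, *]

lemma val_frame (hx : x ∈ U) (a b : Fin 4) :
    g.val x (e.frame a x) (e.frame b x) = if b = dual a then sgn a else 0 := e.ip_frame hx a b

lemma smooth_frame (a : Fin 4) : (e.frame a).SmoothOn U := by
  intro x hx
  fin_cases a
  exacts [e.smooth_l x hx, e.smooth_n x hx, e.smooth_m₁ x hx, e.smooth_m₂ x hx]

/-- Coordinates of a vector field in the frame. -/
def co (V : VField M) (b : Fin 4) (x : M) : ℝ := sgn b * g.ip V (e.frame (dual b)) x

lemma linearIndependent_frame (hx : x ∈ U) :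
    LinearIndependent ℝ (fun a ↦ e.frame a x) := by
  rw [Fintype.linearIndependent_iff]
  intro c hc i
  have h := congrArg (fun v ↦ g.val x v (e.frame (dual i) x)) hc
  simp only [map_sum, map_smul, sum_apply, smul_apply,
    e.val_frame hx, smul_eq_mul, map_zero, zero_apply] at h
  rw [Finset.sum_eq_single i] at h
  · have := sgn_mul_self i
    simp at h
    rcases h with h | h
    · exact h
    · simp [h] at this
  · intro b _ hb
    have : dual i ≠ dual b := fun h ↦ hb (by rw [← dual_dual b, ← h, dual_dual])
    simp [this]
  · simp

/-- Up to signs the null frame is its own dual basis with ℓ and n exchanged, so pairing with `dual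
b` isolates the coefficient of `e.frame b`. -/
lemma expand_vector (hx : x ∈ U) (v : TangentSpace (𝓡 4) x) :
    v = ∑ b, (sgn b * g.val x v (e.frame (dual b) x)) • e.frame b x := by
  have hcard : Fintype.card (Fin 4) = Module.finrank ℝ (TangentSpace (𝓡 4) x) := by
    change Fintype.card (Fin 4) = Module.finrank ℝ R4
    simp
  have hspan := (e.linearIndependent_frame hx).span_eq_top_of_card_eq_finrank hcard
  have hv : v ∈ Submodule.span ℝ (Set.range fun a ↦ e.frame a x) := by rw [hspan]; trivial
  obtain ⟨c, rfl⟩ := (Submodule.mem_span_range_iff_exists_fun ℝ).1 hv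
  refine Finset.sum_congr rfl fun b _ ↦ ?_
  congr 1
  simp only [map_sum, map_smul, sum_apply, smul_apply,
    e.val_frame hx, smul_eq_mul]
  rw [Finset.sum_eq_single b]
  · simp only [if_true]
    linear_combination (-c b) * sgn_mul_self b
  · intro a _ hb
    have : dual b ≠ dual a := fun h ↦ hb (by rw [← dual_dual a, ← h, dual_dual])
    simp [this]
  · simp

lemma expand (hx : x ∈ U) (V : VField M) : V x = ∑ b, e.co V b x • e.frame b x :=
  e.expand_vector hx (V x)

include e in
lemma vector_ext (hx : x ∈ U) {v w : TangentSpace (𝓡 4) x}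
    (h : ∀ b, g.val x v (e.frame b x) = g.val x w (e.frame b x)) : v = w := by
  rw [e.expand_vector hx v, e.expand_vector hx w]
  simp [h]

lemma co_smooth {V : VField M} (hV : V.SmoothAt x) (hx : x ∈ U) (b : Fin 4) :
    FSmoothAt (e.co V b) x :=
  (FSmoothAt.const (sgn b)).mul (g.ip_smooth hV (e.smooth_frame _ x hx))

end NPTetrad

end Kundt
end

/-! ### The Levi-Civita connection: existence, smoothness, torsion and metric compatibility. -/

noncomputable section
namespace Kundt

variable {M : Type*} [TopologicalSpace M] [ChartedSpace R4 M] [IsManifold (𝓡 4) ∞ M]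

/-- The predicate under `Classical.epsilon` depends on the two fields only through their germs, so
equal germs give the same predicate and the same choice, even for fields that are not smooth. -/
lemma LorentzianMetric.nablaV_congr (g : LorentzianMetric M) {U : Set M} (hU : IsOpen U) {x : M}
    (hx : x ∈ U) {X X' Y Y' : VField M}
    (hXX : ∀ y ∈ U, X y = X' y) (hYY : ∀ y ∈ U, Y y = Y' y) :
    g.nablaV X Y x = g.nablaV X' Y' x := by
  have h1 : X =ᶠ[nhds x] X' := Filter.eventuallyEq_of_mem (hU.mem_nhds hx) hXX
  have h2 : Y =ᶠ[nhds x] Y' := Filter.eventuallyEq_of_mem (hU.mem_nhds hx) hYY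
  simp only [LorentzianMetric.nablaV]
  congr 1
  funext v
  refine propext (forall_congr' fun W ↦ forall_congr' fun _ ↦ ?_)
  rw [g.koszul_congr h1 h2 (Filter.EventuallyEq.refl _ W)]

namespace NPTetrad

variable {g : LorentzianMetric M} {U : Set M} (e : NPTetrad g U) {x : M}

section derivations

variable {X Y : VField M} {f : M → ℝ}

include e

/-- Since [X, fℓ] - f[X, ℓ] = X(f) ℓ, pairing with n recovers X(f); smoothness is then inherited
from brackets and the metric, without charts. -/
lemma deriv_smoothOn (hU : IsOpen U) (hX : X.SmoothOn U) (hf : FSmoothOn U f) :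
    FSmoothOn U (deriv X f) := by
  refine FSmoothOn.congr hU (f := fun y ↦ g.ip (bracket X (fun z ↦ f z • e.l z)) e.n y
    - f y * g.ip (bracket X e.l) e.n y) ?_ ?_
  · refine FSmoothOn.sub (fun y hy ↦ ?_) (FSmoothOn.mul hf fun y hy ↦ ?_)
    · exact g.ip_smooth ((hX y hy).bracket ((e.smooth_l y hy).smul (hf y hy))) (e.smooth_n y hy)
    · exact g.ip_smooth ((hX y hy).bracket (e.smooth_l y hy)) (e.smooth_n y hy)
  · intro y hy
    have h := bracket_smul_right (X := X) (hf y hy) (e.smooth_l y hy)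
    have h1 := e.l_n y hy
    simp only [LorentzianMetric.ip] at h1 ⊢
    simp [h, h1]

/-- The Jacobi identity for X, Y, fℓ, expanded by the Leibniz rule and paired with n; the identity
for X, Y, ℓ removes the terms without derivatives of f. -/
lemma deriv_commutator (hU : IsOpen U) (hx : x ∈ U) (hX : X.SmoothOn U) (hY : Y.SmoothOn U)
    (hf : FSmoothOn U f) :
    deriv X (deriv Y f) x - deriv Y (deriv X f) x = deriv (bracket X Y) f x := by
  have hl : e.l.SmoothOn U := e.smooth_l
  have key : ∀ {A B : VField M}, A.SmoothOn U → B.SmoothOn U →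
      bracket A (bracket B (fun z ↦ f z • e.l z)) x =
        (deriv A (deriv B f) x • e.l x + deriv B f x • bracket A e.l x)
          + (deriv A f x • bracket B e.l x + f x • bracket A (bracket B e.l) x) := by
    intro A B hA hB
    have h1 : bracket B (fun z ↦ f z • e.l z) =ᶠ[nhds x]
        ((fun z ↦ deriv B f z • e.l z) + fun z ↦ f z • bracket B e.l z : VField M) :=
      Filter.eventuallyEq_of_mem (hU.mem_nhds hx) fun y hy ↦
        bracket_smul_right (hf y hy) (hl y hy)
    rw [bracket_congr (Filter.EventuallyEq.refl _ A) h1, bracket_add_right,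
      bracket_smul_right (e.deriv_smoothOn hU hB hf x hx) (hl x hx),
      bracket_smul_right (hf x hx) ((hB x hx).bracket (hl x hx))]
    · exact (hl x hx).smul (e.deriv_smoothOn hU hB hf x hx)
    · exact ((hB x hx).bracket (hl x hx)).smul (hf x hx)
  have hJ := jacobi (hX x hx) (hY x hx) ((hl x hx).smul (hf x hx))
  have hJ' := jacobi (hX x hx) (hY x hx) (hl x hx)
  rw [key hX hY, key hY hX, bracket_smul_right (hf x hx) (hl x hx), hJ'] at hJ
  have h3 := congrArg (fun v ↦ g.val x v (e.n x)) hJ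
  have h1 : g.val x (e.l x) (e.n x) = 1 := e.l_n x hx
  simp only [map_add, map_smul, add_apply, smul_apply, smul_eq_mul, h1] at h3
  linarith

end derivations

section LeviCivita

variable {X Y Z W : VField M} {f : M → ℝ}

include e

/-- Assembling a vector from the values of the Koszul form on the frame gives a solution of the
defining condition, because the form is linear over functions in its last argument. So the epsilon
choice is legitimate. -/
lemma nablaV_spec (hU : IsOpen U) (hx : x ∈ U) (hX : X.SmoothAt x) (hY : Y.SmoothAt x)
    (hW : W.SmoothAt x) : 2 * g.val x (g.nablaV X Y x) (W x) = g.koszul X Y W x := by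
  have hex : ∃ v : TangentSpace (𝓡 4) x, ∀ W : VField M, W.SmoothAt x →
      2 * g.val x v (W x) = g.koszul X Y W x := by
    refine ⟨∑ b, (1 / 2 * (sgn b * g.koszul X Y (e.frame (dual b)) x)) • e.frame b x, ?_⟩
    intro W hW
    have h1 : W =ᶠ[nhds x] (fun y ↦ ∑ b, e.co W b y • e.frame b y : VField M) :=
      Filter.eventuallyEq_of_mem (hU.mem_nhds hx) fun y hy ↦ e.expand hy W
    rw [g.koszul_congr (Filter.EventuallyEq.refl _ X) (Filter.EventuallyEq.refl _ Y) h1,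
      g.koszul_sum_right hX hY fun b _ ↦ (e.smooth_frame b x hx).smul (e.co_smooth hW hx b),
      e.expand hx W]
    simp only [map_sum, map_smul, sum_apply, smul_apply, smul_eq_mul, e.val_frame hx]
    rw [Finset.mul_sum]
    refine Finset.sum_congr rfl fun b _ ↦ ?_
    rw [g.koszul_smul_right hX hY (e.co_smooth hW hx b) (e.smooth_frame b x hx),
      Finset.sum_eq_single (dual b)]
    · simp only [dual_dual, if_true, sgn_dual]
      linear_combination (e.co W b x * g.koszul X Y (e.frame b) x) * sgn_mul_self b
    · intro a _ ha
      have : b ≠ dual a := fun h ↦ ha (by rw [h, dual_dual])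
      simp [this]
    · simp
  exact Classical.epsilon_spec hex W hW

lemma nablaV_smoothOn (hU : IsOpen U) (hX : X.SmoothOn U) (hY : Y.SmoothOn U) :
    (g.nablaV X Y).SmoothOn U := by
  have hip : ∀ {A B : VField M}, A.SmoothOn U → B.SmoothOn U → FSmoothOn U (g.ip A B) :=
    fun hA hB x hx ↦ g.ip_smooth (hA x hx) (hB x hx)
  refine VField.SmoothOn.congr hU (X := fun y ↦ ∑ b,
    (sgn b * (1 / 2) * g.koszul X Y (e.frame (dual b)) y) • e.frame b y) ?_ ?_
  · refine VField.SmoothOn.sum fun b _ ↦ VField.SmoothOn.smul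
      (FSmoothOn.mul (FSmoothOn.const _) ?_) (e.smooth_frame b)
    have hb := e.smooth_frame (dual b)
    unfold LorentzianMetric.koszul
    exact ((((((e.deriv_smoothOn hU hX (hip hY hb)).add (e.deriv_smoothOn hU hY (hip hX hb))).sub
      (e.deriv_smoothOn hU hb (hip hX hY))).add (hip (hX.bracket hY) hb)).sub
      (hip (hX.bracket hb) hY)).sub (hip (hY.bracket hb) hX))
  · intro y hy
    rw [e.expand_vector hy (g.nablaV X Y y)]
    refine Finset.sum_congr rfl fun b _ ↦ ?_
    rw [← e.nablaV_spec hU hy (hX y hy) (hY y hy) (e.smooth_frame (dual b) y hy)]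
    congr 1
    ring

lemma torsion_free (hU : IsOpen U) (hx : x ∈ U) (hX : X.SmoothAt x) (hY : Y.SmoothAt x) :
    g.nablaV X Y x - g.nablaV Y X x = bracket X Y x := by
  refine e.vector_ext hx fun b ↦ ?_
  have hb := e.smooth_frame b x hx
  have h1 := e.nablaV_spec hU hx hX hY hb
  have h2 := e.nablaV_spec hU hx hY hX hb
  have h3 : g.ip (bracket Y X) (e.frame b) x = - g.ip (bracket X Y) (e.frame b) x := by
    simp only [LorentzianMetric.ip]
    rw [bracket_swap_apply]
    simp
  simp only [LorentzianMetric.koszul, g.ip_comm Y X, h3] at h1 h2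
  have h4 : g.ip (bracket X Y) (e.frame b) x = g.val x (bracket X Y x) (e.frame b x) := rfl
  simp only [map_sub, sub_apply]
  linarith

lemma metric_compat (hU : IsOpen U) (hx : x ∈ U) (hX : X.SmoothAt x) (hY : Y.SmoothAt x)
    (hZ : Z.SmoothAt x) :
    deriv X (g.ip Y Z) x = g.ip (g.nablaV X Y) Z x + g.ip Y (g.nablaV X Z) x := by
  have h1 := e.nablaV_spec hU hx hX hY hZ
  have h2 := e.nablaV_spec hU hx hX hZ hY
  have h3 : g.ip (bracket Z Y) X x = - g.ip (bracket Y Z) X x := by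
    simp only [LorentzianMetric.ip]
    rw [bracket_swap_apply]
    simp
  rw [g.ip_comm Y (g.nablaV X Z)]
  simp only [LorentzianMetric.koszul, g.ip_comm Z Y, h3] at h1 h2
  simp only [LorentzianMetric.ip] at *
  linarith

lemma nablaV_add_right (hU : IsOpen U) (hx : x ∈ U) (hX : X.SmoothAt x) (hY : Y.SmoothAt x)
    (hZ : Z.SmoothAt x) : g.nablaV X (Y + Z) x = g.nablaV X Y x + g.nablaV X Z x := by
  refine e.vector_ext hx fun b ↦ ?_
  have hb := e.smooth_frame b x hx
  have h1 := e.nablaV_spec hU hx hX hY hb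
  have h2 := e.nablaV_spec hU hx hX hZ hb
  have h3 := e.metric_compat hU hx hX (hY.add hZ) hb
  have h4 := e.metric_compat hU hx hX hY hb
  have h5 := e.metric_compat hU hx hX hZ hb
  rw [funext (g.ip_add_left Y Z (e.frame b)), deriv_add X (g.ip_smooth hY hb) (g.ip_smooth hZ hb),
    g.ip_add_left] at h3
  simp only [LorentzianMetric.ip] at *
  simp only [map_add, add_apply]
  linarith

lemma nablaV_smul_right (hU : IsOpen U) (hx : x ∈ U) (hX : X.SmoothAt x) (hf : FSmoothAt f x)
    (hY : Y.SmoothAt x) :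
    g.nablaV X (fun y ↦ f y • Y y) x = deriv X f x • Y x + f x • g.nablaV X Y x := by
  refine e.vector_ext hx fun b ↦ ?_
  have hb := e.smooth_frame b x hx
  have h3 := e.metric_compat hU hx hX (hY.smul hf) hb
  have h4 := e.metric_compat hU hx hX hY hb
  rw [show g.ip (fun y ↦ f y • Y y) (e.frame b) = fun y ↦ f y * g.ip Y (e.frame b) y from
    funext fun y ↦ g.ip_smul_left _ _ _, deriv_mul X hf (g.ip_smooth hY hb), h4,
    g.ip_smul_left] at h3
  simp only [LorentzianMetric.ip] at *
  simp only [map_add, add_apply, map_smul, smul_apply, smul_eq_mul]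
  linarith

/-- Vanishing torsion exchanges the two arguments at the cost of a bracket, reducing the claim to
additivity on the right. -/
lemma nablaV_add_left (hU : IsOpen U) (hx : x ∈ U) (hX : X.SmoothAt x) (hY : Y.SmoothAt x)
    (hZ : Z.SmoothAt x) : g.nablaV (X + Y) Z x = g.nablaV X Z x + g.nablaV Y Z x := by
  have h1 := e.torsion_free hU hx (hX.add hY) hZ
  have h2 := e.torsion_free hU hx hX hZ
  have h3 := e.torsion_free hU hx hY hZ
  rw [e.nablaV_add_right hU hx hZ hX hY, bracket_swap_apply, bracket_add_right hX hY,
    bracket_swap_apply (X := Z), bracket_swap_apply (X := Z), ← h2, ← h3] at h1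
  have := eq_add_of_sub_eq h1
  rw [this]
  abel

lemma nablaV_smul_left (hU : IsOpen U) (hx : x ∈ U) (hX : X.SmoothAt x) (hf : FSmoothAt f x)
    (hZ : Z.SmoothAt x) : g.nablaV (fun y ↦ f y • X y) Z x = f x • g.nablaV X Z x := by
  have h1 := e.torsion_free hU hx (hX.smul hf) hZ
  have h2 := e.torsion_free hU hx hX hZ
  rw [e.nablaV_smul_right hU hx hZ hf hX, bracket_swap_apply, bracket_smul_right hf hX,
    bracket_swap_apply (X := Z), ← h2] at h1
  rw [eq_add_of_sub_eq h1, smul_neg, smul_sub]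
  abel

end LeviCivita

end NPTetrad

end Kundt
end

/-! ### Curvature: linearity over functions, skew symmetry, first Bianchi identity. -/

noncomputable section
namespace Kundt

variable {M : Type*} [TopologicalSpace M] [ChartedSpace R4 M]

lemma bracket_congr_on {U : Set M} (hU : IsOpen U) {x : M} (hx : x ∈ U) {X X' Y Y' : VField M}
    (hX : ∀ y ∈ U, X y = X' y) (hY : ∀ y ∈ U, Y y = Y' y) : bracket X Y x = bracket X' Y' x :=
  bracket_congr (Filter.eventuallyEq_of_mem (hU.mem_nhds hx) hX)
    (Filter.eventuallyEq_of_mem (hU.mem_nhds hx) hY)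

variable [IsManifold (𝓡 4) ∞ M]

lemma LorentzianMetric.curvature_congr (g : LorentzianMetric M) {U : Set M} (hU : IsOpen U) {x : M}
    (hx : x ∈ U) {X X' Y Y' Z Z' : VField M} (hX : ∀ y ∈ U, X y = X' y) (hY : ∀ y ∈ U, Y y = Y' y)
    (hZ : ∀ y ∈ U, Z y = Z' y) : g.curvature X Y Z x = g.curvature X' Y' Z' x := by
  simp only [LorentzianMetric.curvature, Pi.sub_apply]
  rw [g.nablaV_congr hU hx hX fun y hy ↦ g.nablaV_congr hU hy hY hZ,
    g.nablaV_congr hU hx hY fun y hy ↦ g.nablaV_congr hU hy hX hZ,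
    g.nablaV_congr hU hx (fun y hy ↦ bracket_congr_on hU hy hX hY) hZ]

namespace NPTetrad

variable {g : LorentzianMetric M} {U : Set M} (e : NPTetrad g U) {x : M}

section curvature

variable {X Y Z W : VField M} {f : M → ℝ}

include e

lemma curvature_smoothOn (hU : IsOpen U) (hX : X.SmoothOn U) (hY : Y.SmoothOn U)
    (hZ : Z.SmoothOn U) : (g.curvature X Y Z).SmoothOn U :=
  ((e.nablaV_smoothOn hU hX (e.nablaV_smoothOn hU hY hZ)).sub
    (e.nablaV_smoothOn hU hY (e.nablaV_smoothOn hU hX hZ))).sub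
    (e.nablaV_smoothOn hU (hX.bracket hY) hZ)

lemma curvature_swap (hU : IsOpen U) (hx : x ∈ U) (hX : X.SmoothOn U) (hY : Y.SmoothOn U)
    (hZ : Z.SmoothOn U) : g.curvature X Y Z x = - g.curvature Y X Z x := by
  have h1 : g.nablaV (bracket X Y) Z x = - g.nablaV (bracket Y X) Z x := by
    rw [g.nablaV_congr hU hx (X' := fun y ↦ (-1 : ℝ) • bracket Y X y) (Y' := Z)
      (fun y _ ↦ by rw [bracket_swap_apply]; simp) (fun _ _ ↦ rfl),
      e.nablaV_smul_left hU hx (hY.bracket hX x hx) (FSmoothAt.const (-1)) (hZ x hx)]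
    simp
  simp only [LorentzianMetric.curvature, Pi.sub_apply, h1]
  abel

lemma curvature_add_left (hU : IsOpen U) (hx : x ∈ U) (hX : X.SmoothOn U) (hW : W.SmoothOn U)
    (hY : Y.SmoothOn U) (hZ : Z.SmoothOn U) :
    g.curvature (X + W) Y Z x = g.curvature X Y Z x + g.curvature W Y Z x := by
  have h1 := e.nablaV_add_left hU hx (hX x hx) (hW x hx) (e.nablaV_smoothOn hU hY hZ x hx)
  have h2 : g.nablaV Y (g.nablaV (X + W) Z) x
      = g.nablaV Y (g.nablaV X Z) x + g.nablaV Y (g.nablaV W Z) x := by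
    rw [g.nablaV_congr hU hx (X' := Y) (Y' := g.nablaV X Z + g.nablaV W Z) (fun _ _ ↦ rfl)
      (fun y hy ↦ e.nablaV_add_left hU hy (hX y hy) (hW y hy) (hZ y hy)),
      e.nablaV_add_right hU hx (hY x hx) (e.nablaV_smoothOn hU hX hZ x hx)
        (e.nablaV_smoothOn hU hW hZ x hx)]
  have h3 : g.nablaV (bracket (X + W) Y) Z x
      = g.nablaV (bracket X Y) Z x + g.nablaV (bracket W Y) Z x := by
    rw [g.nablaV_congr hU hx (X' := bracket X Y + bracket W Y) (Y' := Z)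
      (fun y hy ↦ ?_) (fun _ _ ↦ rfl),
      e.nablaV_add_left hU hx (hX.bracket hY x hx) (hW.bracket hY x hx) (hZ x hx)]
    rw [bracket_swap_apply, bracket_add_right (hX y hy) (hW y hy), neg_add, Pi.add_apply,
      bracket_swap_apply (X := X), bracket_swap_apply (X := W)]
  simp only [LorentzianMetric.curvature, Pi.sub_apply, h1, h2, h3]
  abel

lemma curvature_smul_left (hU : IsOpen U) (hx : x ∈ U) (hX : X.SmoothOn U) (hf : FSmoothOn U f)
    (hY : Y.SmoothOn U) (hZ : Z.SmoothOn U) :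
    g.curvature (fun y ↦ f y • X y) Y Z x = f x • g.curvature X Y Z x := by
  have hYf : FSmoothOn U (fun y ↦ - deriv Y f y) := (e.deriv_smoothOn hU hY hf).neg
  have h1 := e.nablaV_smul_left hU hx (hX x hx) (hf x hx) (e.nablaV_smoothOn hU hY hZ x hx)
  have h2 : g.nablaV Y (g.nablaV (fun y ↦ f y • X y) Z) x
      = deriv Y f x • g.nablaV X Z x + f x • g.nablaV Y (g.nablaV X Z) x := by
    rw [g.nablaV_congr hU hx (X' := Y) (Y' := fun y ↦ f y • g.nablaV X Z y) (fun _ _ ↦ rfl)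
      (fun y hy ↦ e.nablaV_smul_left hU hy (hX y hy) (hf y hy) (hZ y hy)),
      e.nablaV_smul_right hU hx (hY x hx) (hf x hx) (e.nablaV_smoothOn hU hX hZ x hx)]
  have h3 : g.nablaV (bracket (fun y ↦ f y • X y) Y) Z x
      = (- deriv Y f x) • g.nablaV X Z x + f x • g.nablaV (bracket X Y) Z x := by
    rw [g.nablaV_congr hU hx
      (X' := ((fun y ↦ (- deriv Y f y) • X y) + fun y ↦ f y • bracket X Y y : VField M)) (Y' := Z)
      (fun y hy ↦ ?_) (fun _ _ ↦ rfl),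
      e.nablaV_add_left hU hx (hX.smul hYf x hx) ((hX.bracket hY).smul hf x hx) (hZ x hx),
      e.nablaV_smul_left hU hx (hX x hx) (hYf x hx) (hZ x hx),
      e.nablaV_smul_left hU hx (hX.bracket hY x hx) (hf x hx) (hZ x hx)]
    rw [bracket_swap_apply, bracket_smul_right (hf y hy) (hX y hy), Pi.add_apply,
      bracket_swap_apply (X := X)]
    simp
    abel
  simp only [LorentzianMetric.curvature, Pi.sub_apply, h1, h2, h3, smul_sub, neg_smul]
  abel

lemma curvature_add_right (hU : IsOpen U) (hx : x ∈ U) (hX : X.SmoothOn U) (hY : Y.SmoothOn U)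
    (hZ : Z.SmoothOn U) (hW : W.SmoothOn U) :
    g.curvature X Y (Z + W) x = g.curvature X Y Z x + g.curvature X Y W x := by
  have h : ∀ {A B : VField M}, A.SmoothOn U → B.SmoothOn U → g.nablaV A (g.nablaV B (Z + W)) x
      = g.nablaV A (g.nablaV B Z) x + g.nablaV A (g.nablaV B W) x := by
    intro A B hA hB
    rw [g.nablaV_congr hU hx (X' := A) (Y' := g.nablaV B Z + g.nablaV B W) (fun _ _ ↦ rfl)
      (fun y hy ↦ e.nablaV_add_right hU hy (hB y hy) (hZ y hy) (hW y hy)),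
      e.nablaV_add_right hU hx (hA x hx) (e.nablaV_smoothOn hU hB hZ x hx)
        (e.nablaV_smoothOn hU hB hW x hx)]
  simp only [LorentzianMetric.curvature, Pi.sub_apply, h hX hY, h hY hX,
    e.nablaV_add_right hU hx (hX.bracket hY x hx) (hZ x hx) (hW x hx)]
  abel

/-- The first-derivative cross terms are symmetric in X and Y, and the second derivatives of f
combine to [X, Y](f) by `deriv_commutator`, which the bracket term cancels. -/
lemma curvature_smul_right (hU : IsOpen U) (hx : x ∈ U) (hX : X.SmoothOn U) (hY : Y.SmoothOn U)
    (hf : FSmoothOn U f) (hZ : Z.SmoothOn U) :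
    g.curvature X Y (fun y ↦ f y • Z y) x = f x • g.curvature X Y Z x := by
  have h : ∀ {A B : VField M}, A.SmoothOn U → B.SmoothOn U →
      g.nablaV A (g.nablaV B fun y ↦ f y • Z y) x
      = (deriv A (deriv B f) x • Z x + deriv B f x • g.nablaV A Z x)
        + (deriv A f x • g.nablaV B Z x + f x • g.nablaV A (g.nablaV B Z) x) := by
    intro A B hA hB
    have hBf := e.deriv_smoothOn hU hB hf
    rw [g.nablaV_congr hU hx (X' := A)
      (Y' := ((fun y ↦ deriv B f y • Z y) + fun y ↦ f y • g.nablaV B Z y : VField M))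
      (fun _ _ ↦ rfl) (fun y hy ↦ e.nablaV_smul_right hU hy (hB y hy) (hf y hy) (hZ y hy)),
      e.nablaV_add_right hU hx (hA x hx) (hZ.smul hBf x hx)
        ((e.nablaV_smoothOn hU hB hZ).smul hf x hx),
      e.nablaV_smul_right hU hx (hA x hx) (hBf x hx) (hZ x hx),
      e.nablaV_smul_right hU hx (hA x hx) (hf x hx) (e.nablaV_smoothOn hU hB hZ x hx)]
  simp only [LorentzianMetric.curvature, Pi.sub_apply, h hX hY, h hY hX,
    e.nablaV_smul_right hU hx (hX.bracket hY x hx) (hf x hx) (hZ x hx),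
    ← e.deriv_commutator hU hx hX hY hf, sub_smul, smul_sub]
  abel

/-- Apply [X, Y] = XY - YX to the function g(Z, W) and expand both sides by metric compatibility;
the mixed terms cancel. -/
lemma curvature_skew (hU : IsOpen U) (hx : x ∈ U) (hX : X.SmoothOn U) (hY : Y.SmoothOn U)
    (hZ : Z.SmoothOn U) (hW : W.SmoothOn U) :
    g.ip (g.curvature X Y Z) W x + g.ip Z (g.curvature X Y W) x = 0 := by
  have h : ∀ {A B : VField M}, A.SmoothOn U → B.SmoothOn U → deriv A (deriv B (g.ip Z W)) x =
      (g.ip (g.nablaV A (g.nablaV B Z)) W x + g.ip (g.nablaV B Z) (g.nablaV A W) x)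
      + (g.ip (g.nablaV A Z) (g.nablaV B W) x + g.ip Z (g.nablaV A (g.nablaV B W)) x) := by
    intro A B hA hB
    have hBZ := e.nablaV_smoothOn hU hB hZ x hx
    have hBW := e.nablaV_smoothOn hU hB hW x hx
    rw [deriv_congr_on hU hx A (h := fun y ↦ g.ip (g.nablaV B Z) W y + g.ip Z (g.nablaV B W) y)
      (fun y hy ↦ e.metric_compat hU hy (hB y hy) (hZ y hy) (hW y hy)),
      deriv_add A (g.ip_smooth hBZ (hW x hx)) (g.ip_smooth (hZ x hx) hBW),
      e.metric_compat hU hx (hA x hx) hBZ (hW x hx), e.metric_compat hU hx (hA x hx) (hZ x hx) hBW]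
  have hc := e.deriv_commutator hU hx hX hY (f := g.ip Z W)
    fun y hy ↦ g.ip_smooth (hZ y hy) (hW y hy)
  rw [h hX hY, h hY hX,
    e.metric_compat hU hx (hX.bracket hY x hx) (hZ x hx) (hW x hx)] at hc
  simp only [LorentzianMetric.ip, LorentzianMetric.curvature, Pi.sub_apply, map_sub,
    sub_apply] at *
  linarith

/-- Vanishing torsion turns the cyclic sum into a cyclic sum of double brackets, which is zero by
Jacobi. -/
lemma bianchi (hU : IsOpen U) (hx : x ∈ U) (hX : X.SmoothOn U) (hY : Y.SmoothOn U)
    (hZ : Z.SmoothOn U) :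
    g.curvature X Y Z x + g.curvature Y Z X x + g.curvature Z X Y x = 0 := by
  have h : ∀ {A B C : VField M}, A.SmoothOn U → B.SmoothOn U → C.SmoothOn U →
      g.nablaV A (g.nablaV B C) x = g.nablaV A (g.nablaV C B) x + g.nablaV (bracket B C) A x
        + bracket A (bracket B C) x := by
    intro A B C hA hB hC
    rw [← e.torsion_free hU hx (hA x hx) (hB.bracket hC x hx),
      g.nablaV_congr hU hx (X' := A) (Y' := g.nablaV C B + bracket B C) (fun _ _ ↦ rfl) ?_,
      e.nablaV_add_right hU hx (hA x hx) (e.nablaV_smoothOn hU hC hB x hx)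
        (hB.bracket hC x hx)]
    · abel
    · intro y hy
      rw [Pi.add_apply, ← e.torsion_free hU hy (hB y hy) (hC y hy)]
      abel
  have hJ := jacobi (hX x hx) (hY x hx) (hZ x hx)
  have hs' : bracket Y (bracket X Z) x = - bracket Y (bracket Z X) x := by
    have h1 : bracket X Z =ᶠ[nhds x] fun y ↦ (-1 : ℝ) • bracket Z X y :=
      Filter.Eventually.of_forall fun y ↦ by
        change bracket X Z y = (-1 : ℝ) • bracket Z X y
        rw [bracket_swap_apply]; simp
    rw [bracket_congr (Filter.EventuallyEq.refl _ Y) h1,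
      bracket_smul_right (FSmoothAt.const (-1)) (hZ.bracket hX x hx), deriv_const]
    simp
  rw [hs', show bracket (bracket X Y) Z x = - bracket Z (bracket X Y) x from
    bracket_swap_apply] at hJ
  simp only [LorentzianMetric.curvature, Pi.sub_apply]
  rw [h hX hY hZ, h hY hZ hX, h hZ hX hY, hJ]
  abel

end curvature

end NPTetrad

end Kundt
end

/-! ### Tensoriality of Riem and of its covariant derivatives. -/

noncomputable section
namespace Kundt

variable {M : Type*} [TopologicalSpace M] [ChartedSpace R4 M] [IsManifold (𝓡 4) ∞ M]

/-- On `U`, the covariant tensor field `T` is local, smooth, and multilinear over smooth functions,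
when evaluated on vector fields smooth on `U`. -/
structure IsTensorial (U : Set M) {k : ℕ} (T : CovTensor M k) : Prop where
  smooth : ∀ V : Fin k → VField M, (∀ j, (V j).SmoothOn U) → FSmoothOn U (T V)
  congr : ∀ V V' : Fin k → VField M, (∀ j, ∀ y ∈ U, V j y = V' j y) → ∀ x ∈ U, T V x = T V' x
  add : ∀ V : Fin k → VField M, (∀ j, (V j).SmoothOn U) → ∀ i (X Y : VField M), X.SmoothOn U →
    Y.SmoothOn U → ∀ x ∈ U, T (Function.update V i (X + Y)) x
      = T (Function.update V i X) x + T (Function.update V i Y) x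
  smul : ∀ V : Fin k → VField M, (∀ j, (V j).SmoothOn U) → ∀ i (f : M → ℝ) (X : VField M),
    FSmoothOn U f → X.SmoothOn U → ∀ x ∈ U, T (Function.update V i (fun y ↦ f y • X y)) x
      = f x * T (Function.update V i X) x

lemma smoothOn_update {U : Set M} {k : ℕ} {V : Fin k → VField M} (hV : ∀ j, (V j).SmoothOn U)
    (i : Fin k) {X : VField M} (hX : X.SmoothOn U) (j : Fin k) :
    (Function.update V i X j).SmoothOn U := by
  by_cases h : j = i
  · subst h; simpa using hX
  · simpa [h] using hV j

lemma IsTensorial.sum {U : Set M} {k : ℕ} {T : CovTensor M k} (hT : IsTensorial U T)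
    {V : Fin k → VField M} (hV : ∀ j, (V j).SmoothOn U) (i : Fin k) {ι : Type*} (s : Finset ι)
    (f : ι → M → ℝ) (X : ι → VField M) (hf : ∀ a, FSmoothOn U (f a)) (hX : ∀ a, (X a).SmoothOn U)
    {x : M} (hx : x ∈ U) :
    T (Function.update V i (fun y ↦ ∑ a ∈ s, f a y • X a y)) x
      = ∑ a ∈ s, f a x * T (Function.update V i (X a)) x := by
  classical
  induction s using Finset.induction_on with
  | empty =>
    have h := hT.smul V hV i (fun _ ↦ 0) (V i) (FSmoothOn.const 0) (hV i) x hx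
    simpa using h
  | insert a s ha ih =>
    simp only [Finset.sum_insert ha]
    rw [← ih, ← hT.smul V hV i (f a) (X a) (hf a) (hX a) x hx]
    exact hT.add V hV i _ _ ((hX a).smul (hf a))
      (VField.SmoothOn.sum fun b _ ↦ (hX b).smul (hf b)) x hx

namespace NPTetrad

variable {g : LorentzianMetric M} {U : Set M} (e : NPTetrad g U) {x : M}

include e

lemma isTensorial_riem (hU : IsOpen U) : IsTensorial U g.riem where
  smooth V hV x hx := g.ip_smooth (hV 0 x hx)
    (e.curvature_smoothOn hU (hV 2) (hV 3) (hV 1) x hx)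
  congr V V' h x hx := by
    simp only [LorentzianMetric.riem, LorentzianMetric.ip, h 0 x hx,
      g.curvature_congr hU hx (h 2) (h 3) (h 1)]
  add V hV i X Y hX hY x hx := by
    have h2 := e.curvature_add_left hU hx hX hY (hV 3) (hV 1)
    have h3 := e.curvature_add_left hU hx hX hY (hV 2) (hV 1)
    have h1 := e.curvature_add_right hU hx (hV 2) (hV 3) hX hY
    fin_cases i <;> simp [LorentzianMetric.riem, LorentzianMetric.ip, Function.update, h1, h2]
    rw [e.curvature_swap hU hx (hV 2) (hX.add hY) (hV 1), h3,
      e.curvature_swap hU hx (hV 2) hX (hV 1), e.curvature_swap hU hx (hV 2) hY (hV 1)]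
    simp
    ring
  smul V hV i f X hf hX x hx := by
    have h2 := e.curvature_smul_left hU hx hX hf (hV 3) (hV 1)
    have h3 := e.curvature_smul_left hU hx hX hf (hV 2) (hV 1)
    have h1 := e.curvature_smul_right hU hx (hV 2) (hV 3) hf hX
    fin_cases i <;> simp [LorentzianMetric.riem, LorentzianMetric.ip, Function.update, h1, h2]
    rw [e.curvature_swap hU hx (hV 2) (hX.smul hf) (hV 1), h3,
      e.curvature_swap hU hx (hV 2) hX (hV 1)]
    simp

lemma isTensorial_nabla (hU : IsOpen U) {k : ℕ} {T : CovTensor M k} (hT : IsTensorial U T) :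
    IsTensorial U (g.nabla T) where
  smooth V hV := by
    have ht : ∀ j, (Fin.tail V j).SmoothOn U := fun j ↦ hV j.succ
    unfold LorentzianMetric.nabla
    exact (e.deriv_smoothOn hU (hV 0) (hT.smooth _ ht)).sub (FSmoothOn.sum fun i _ ↦
      hT.smooth _ (smoothOn_update ht i (e.nablaV_smoothOn hU (hV 0) (ht i))))
  congr V V' h x hx := by
    have ht : ∀ j, ∀ y ∈ U, Fin.tail V j y = Fin.tail V' j y := fun j ↦ h j.succ
    unfold LorentzianMetric.nabla
    rw [deriv_congr_on hU hx (V 0) (hT.congr _ _ ht), deriv_dir_congr (h 0 x hx)]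
    congr 1
    refine Finset.sum_congr rfl fun i _ ↦ hT.congr _ _ (fun j y hy ↦ ?_) x hx
    by_cases hj : j = i
    · subst hj; simpa using g.nablaV_congr hU hy (h 0) (ht j)
    · simpa [hj] using ht j y hy
  add V hV i X Y hX hY x hx := by
    refine Fin.cases ?_ (fun i ↦ ?_) i
    · have ht : ∀ j, (Fin.tail V j).SmoothOn U := fun j ↦ hV j.succ
      simp only [LorentzianMetric.nabla, Fin.tail_update_zero, Function.update_self, deriv_dir_add]
      rw [sub_add_sub_comm, ← Finset.sum_add_distrib]
      congr 1
      refine Finset.sum_congr rfl fun j _ ↦ ?_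
      rw [← hT.add _ ht j _ _ (e.nablaV_smoothOn hU hX (ht j)) (e.nablaV_smoothOn hU hY (ht j)) x hx]
      refine hT.congr _ _ (fun m y hy ↦ ?_) x hx
      by_cases hj : m = j
      · subst hj; simpa using e.nablaV_add_left hU hy (hX y hy) (hY y hy) (ht m y hy)
      · simp [hj]
    · have ht : ∀ j, (Fin.tail V j).SmoothOn U := fun j ↦ hV j.succ
      simp only [LorentzianMetric.nabla, Fin.tail_update_succ]
      rw [Function.update_of_ne (Fin.succ_ne_zero i).symm,
        Function.update_of_ne (Fin.succ_ne_zero i).symm,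
        Function.update_of_ne (Fin.succ_ne_zero i).symm,
        deriv_congr_on hU hx _ (hT.add _ ht i X Y hX hY),
        deriv_add _ (hT.smooth _ (smoothOn_update ht i hX) x hx)
          (hT.smooth _ (smoothOn_update ht i hY) x hx),
        sub_add_sub_comm, ← Finset.sum_add_distrib]
      congr 1
      refine Finset.sum_congr rfl fun j _ ↦ ?_
      by_cases hj : j = i
      · subst hj
        simp only [Function.update_self, Function.update_idem]
        rw [← hT.add _ ht j _ _ (e.nablaV_smoothOn hU (hV 0) hX) (e.nablaV_smoothOn hU (hV 0) hY)
          x hx]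
        refine hT.congr _ _ (fun m y hy ↦ ?_) x hx
        by_cases hm : m = j
        · subst hm
          simpa using e.nablaV_add_right hU hy (hV 0 y hy) (hX y hy) (hY y hy)
        · simp [hm]
      · simp only [Function.update_of_ne hj, Function.update_comm (Ne.symm hj)]
        exact hT.add _ (smoothOn_update ht j (e.nablaV_smoothOn hU (hV 0) (ht j))) i X Y hX hY x hx
  smul V hV i f X hf hX x hx := by
    refine Fin.cases ?_ (fun i ↦ ?_) i
    · have ht : ∀ j, (Fin.tail V j).SmoothOn U := fun j ↦ hV j.succ
      simp only [LorentzianMetric.nabla, Fin.tail_update_zero, Function.update_self, deriv_dir_smul]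
      rw [mul_sub, Finset.mul_sum]
      congr 1
      refine Finset.sum_congr rfl fun j _ ↦ ?_
      rw [← hT.smul _ ht j f _ hf (e.nablaV_smoothOn hU hX (ht j)) x hx]
      refine hT.congr _ _ (fun m y hy ↦ ?_) x hx
      by_cases hj : m = j
      · subst hj; simpa using e.nablaV_smul_left hU hy (hX y hy) (hf y hy) (ht m y hy)
      · simp [hj]
    · have ht : ∀ j, (Fin.tail V j).SmoothOn U := fun j ↦ hV j.succ
      simp only [LorentzianMetric.nabla, Fin.tail_update_succ]
      rw [Function.update_of_ne (Fin.succ_ne_zero i).symm,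
        Function.update_of_ne (Fin.succ_ne_zero i).symm,
        deriv_congr_on hU hx _ (hT.smul _ ht i f X hf hX),
        deriv_mul _ (hf x hx) (hT.smooth _ (smoothOn_update ht i hX) x hx),
        mul_sub, Finset.mul_sum, ← Finset.add_sum_erase _ _ (Finset.mem_univ i),
        ← Finset.add_sum_erase Finset.univ (fun j ↦ f x * _) (Finset.mem_univ i)]
      -- The slot carrying f • X is the only one that produces X₀(f) T, where X₀ is the direction of
      -- differentiation; this cancels the Leibniz term of the leading derivative.
      have h1 : T (Function.update (Function.update (Fin.tail V) i fun y ↦ f y • X y) i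
          (g.nablaV (V 0) (Function.update (Fin.tail V) i (fun y ↦ f y • X y) i))) x
          = deriv (V 0) f x * T (Function.update (Fin.tail V) i X) x
            + f x * T (Function.update (Fin.tail V) i (g.nablaV (V 0) X)) x := by
        simp only [Function.update_self, Function.update_idem]
        have hdf := e.deriv_smoothOn hU (hV 0) hf
        have hn := e.nablaV_smoothOn hU (hV 0) hX
        rw [← hT.smul _ ht i _ X hdf hX x hx, ← hT.smul _ ht i f _ hf hn x hx,
          ← hT.add _ ht i _ _ (hX.smul hdf) (hn.smul hf) x hx]
        refine hT.congr _ _ (fun m y hy ↦ ?_) x hx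
        by_cases hm : m = i
        · subst hm
          simpa using e.nablaV_smul_right hU hy (hV 0 y hy) (hf y hy) (hX y hy)
        · simp [hm]
      have h2 : ∀ j ∈ Finset.univ.erase i,
          T (Function.update (Function.update (Fin.tail V) i fun y ↦ f y • X y) j
            (g.nablaV (V 0) (Function.update (Fin.tail V) i (fun y ↦ f y • X y) j))) x
          = f x * T (Function.update (Function.update (Fin.tail V) i X) j
            (g.nablaV (V 0) (Function.update (Fin.tail V) i X j))) x := by
        intro j hj
        have hj : j ≠ i := Finset.ne_of_mem_erase hj
        simp only [Function.update_of_ne hj, Function.update_comm (Ne.symm hj)]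
        exact hT.smul _ (smoothOn_update ht j (e.nablaV_smoothOn hU (hV 0) (ht j))) i f X hf hX x hx
      rw [h1, Finset.sum_congr rfl h2]
      simp only [Function.update_self, Function.update_idem]
      ring

lemma isTensorial_nablaRiem (hU : IsOpen U) (n : ℕ) : IsTensorial U (g.nablaRiem n) := by
  induction n with
  | zero => exact e.isTensorial_riem hU
  | succ n ih => exact e.isTensorial_nabla hU ih

end NPTetrad

end Kundt
end

/-! ### Frame components, connection matrices, structure equation and Ricci identity. -/

noncomputable section
namespace Kundt

section act

variable {k : ℕ}

/-- The derivation extension of the matrix `A` to arrays of tensor components. -/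
def act (A : Matrix (Fin 4) (Fin 4) ℝ) (t : (Fin k → Fin 4) → ℝ) (I : Fin k → Fin 4) : ℝ :=
  ∑ i, ∑ b, A (I i) b * t (Function.update I i b)

variable (A B : Matrix (Fin 4) (Fin 4) ℝ) (t s : (Fin k → Fin 4) → ℝ) (I : Fin k → Fin 4)

lemma act_add_left : act (A + B) t I = act A t I + act B t I := by
  simp [act, add_mul, Finset.sum_add_distrib]

lemma act_sub_left : act (A - B) t I = act A t I - act B t I := by
  simp [act, sub_mul, Finset.sum_sub_distrib]

lemma act_smul_left (c : ℝ) : act (c • A) t I = c * act A t I := by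
  simp [act, Finset.mul_sum, mul_assoc]

lemma act_sum_left {ι : Type*} (u : Finset ι) (A : ι → Matrix (Fin 4) (Fin 4) ℝ) :
    act (∑ f ∈ u, A f) t I = ∑ f ∈ u, act (A f) t I := by
  classical
  induction u using Finset.induction_on with
  | empty => simp [act]
  | insert a u ha ih => rw [Finset.sum_insert ha, Finset.sum_insert ha, act_add_left, ih]

lemma act_sub_right : act A (fun J ↦ t J - s J) I = act A t I - act A s I := by
  simp [act, mul_sub, Finset.sum_sub_distrib]

lemma act_neg_right : act A (fun J ↦ - t J) I = - act A t I := by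
  simp [act]

lemma act_cons (t : (Fin (k + 1) → Fin 4) → ℝ) (d : Fin 4) :
    act A t (Fin.cons d I) = ∑ f, A d f * t (Fin.cons f I)
      + act A (fun J ↦ t (Fin.cons d J)) I := by
  simp [act, Fin.sum_univ_succ, Fin.cons_update]

lemma act_act_aux : act A (act B t) I = act (A * B) t I + ∑ i, ∑ j ∈ Finset.univ.erase i,
    ∑ b, ∑ c, A (I i) b * B (I j) c * t (Function.update (Function.update I i b) j c) := by
  simp only [act]
  rw [← Finset.sum_add_distrib]
  refine Finset.sum_congr rfl fun i _ ↦ ?_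
  rw [Finset.sum_comm (s := Finset.univ.erase i)]
  simp only [Matrix.mul_apply, Finset.sum_mul]
  rw [Finset.sum_comm (s := Finset.univ) (t := Finset.univ)
    (f := fun b c ↦ A (I i) c * B c b * t (Function.update I i b)), ← Finset.sum_add_distrib]
  refine Finset.sum_congr rfl fun b _ ↦ ?_
  rw [← Finset.add_sum_erase _ _ (Finset.mem_univ i), mul_add, Finset.mul_sum, Finset.mul_sum]
  congr 1
  · refine Finset.sum_congr rfl fun c _ ↦ ?_
    simp [mul_assoc]
  · refine Finset.sum_congr rfl fun j hj ↦ ?_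
    have hj : j ≠ i := Finset.ne_of_mem_erase hj
    rw [Finset.mul_sum]
    refine Finset.sum_congr rfl fun c _ ↦ ?_
    rw [Function.update_of_ne hj, mul_assoc]

/-- `act` is a Lie algebra representation: terms acting on two different slots are symmetric under
exchange of A and B, so only the terms acting twice on one slot remain. -/
lemma act_commutator :
    act A (act B t) I - act B (act A t) I = act (A * B - B * A) t I := by
  have h : (∑ i, ∑ j ∈ Finset.univ.erase i, ∑ b, ∑ c,
      A (I i) b * B (I j) c * t (Function.update (Function.update I i b) j c))
      = ∑ i, ∑ j ∈ Finset.univ.erase i, ∑ b, ∑ c,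
      B (I i) b * A (I j) c * t (Function.update (Function.update I i b) j c) := by
    rw [Finset.sum_comm' (t' := Finset.univ) (s' := fun j ↦ Finset.univ.erase j)
      (by intro i j; simp [eq_comm])]
    refine Finset.sum_congr rfl fun j _ ↦ Finset.sum_congr rfl fun i hi ↦ ?_
    have hi : i ≠ j := Finset.ne_of_mem_erase hi
    rw [Finset.sum_comm]
    refine Finset.sum_congr rfl fun c _ ↦ Finset.sum_congr rfl fun b _ ↦ ?_
    rw [Function.update_comm hi]
    ring
  rw [act_act_aux, act_act_aux, act_sub_left, h]
  ring

end act

variable {M : Type*} [TopologicalSpace M] [ChartedSpace R4 M] [IsManifold (𝓡 4) ∞ M]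

namespace NPTetrad

variable {g : LorentzianMetric M} {U : Set M} (e : NPTetrad g U) {x : M}

/-- Frame components of a covariant tensor field. -/
def comp {k : ℕ} (T : CovTensor M k) (x : M) (I : Fin k → Fin 4) : ℝ := T (fun j ↦ e.frame (I j)) x

/-- Frame components of the connection: row `a` contains the coordinates of `∇_{e_c} e_a`. -/
def Γ (c : Fin 4) (x : M) : Matrix (Fin 4) (Fin 4) ℝ :=
  fun a b ↦ e.co (g.nablaV (e.frame c) (e.frame a)) b x

/-- The derivative of the matrix `Γ d` along `e_c`. -/
def dΓ (c d : Fin 4) (x : M) : Matrix (Fin 4) (Fin 4) ℝ :=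
  fun a b ↦ deriv (e.frame c) (fun y ↦ e.Γ d y a b) x

/-- Curvature matrices: row `a` contains the coordinates of `R(e_c, e_d) e_a`. -/
def Rm (c d : Fin 4) (x : M) : Matrix (Fin 4) (Fin 4) ℝ :=
  fun a b ↦ e.co (g.curvature (e.frame c) (e.frame d) (e.frame a)) b x

lemma Γ_smooth (hU : IsOpen U) (c a b : Fin 4) : FSmoothOn U (fun y ↦ e.Γ c y a b) := fun x hx ↦
  e.co_smooth (e.nablaV_smoothOn hU (e.smooth_frame c) (e.smooth_frame a) x hx) hx b

lemma comp_smooth {k : ℕ} {T : CovTensor M k} (hT : IsTensorial U T) (I : Fin k → Fin 4) :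
    FSmoothOn U (fun y ↦ e.comp T y I) := hT.smooth _ fun j ↦ e.smooth_frame (I j)

lemma co_expand_smooth {V : VField M} (hV : V.SmoothOn U) (b : Fin 4) : FSmoothOn U (e.co V b) :=
  fun x hx ↦ e.co_smooth (hV x hx) hx b

lemma IsTensorial.expand {k : ℕ} {T : CovTensor M k} (hT : IsTensorial U T)
    {V : Fin k → VField M} (hV : ∀ j, (V j).SmoothOn U) (i : Fin k) {X : VField M}
    (hX : X.SmoothOn U) (hx : x ∈ U) :
    T (Function.update V i X) x = ∑ b, e.co X b x * T (Function.update V i (e.frame b)) x := by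
  rw [← hT.sum hV i Finset.univ _ _ (e.co_expand_smooth hX) e.smooth_frame hx]
  refine hT.congr _ _ (fun j y hy ↦ ?_) x hx
  by_cases hj : j = i
  · subst hj; simpa using e.expand hy X
  · simp [hj]

lemma comp_update {k : ℕ} {T : CovTensor M k} (hT : IsTensorial U T) (I : Fin k → Fin 4)
    (i : Fin k) {X : VField M} (hX : X.SmoothOn U) (hx : x ∈ U) :
    T (Function.update (fun j ↦ e.frame (I j)) i X) x
      = ∑ b, e.co X b x * e.comp T x (Function.update I i b) := by
  rw [IsTensorial.expand e hT (fun j ↦ e.smooth_frame (I j)) i hX hx]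
  refine Finset.sum_congr rfl fun b _ ↦ ?_
  congr 2
  funext j
  by_cases hj : j = i
  · subst hj; simp
  · simp [hj]

lemma comp_nabla (hU : IsOpen U) (hx : x ∈ U) {k : ℕ} {T : CovTensor M k} (hT : IsTensorial U T)
    (c : Fin 4) (I : Fin k → Fin 4) :
    e.comp (g.nabla T) x (Fin.cons c I)
      = deriv (e.frame c) (fun y ↦ e.comp T y I) x - act (e.Γ c x) (e.comp T x) I := by
  have ht : Fin.tail (fun j ↦ e.frame ((Fin.cons c I : Fin (k + 1) → Fin 4) j))
      = fun j ↦ e.frame (I j) := by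
    funext j; simp [Fin.tail]
  simp only [comp, LorentzianMetric.nabla, ht, Fin.cons_zero]
  congr 1
  exact Finset.sum_congr rfl fun i _ ↦
    e.comp_update hT I i (e.nablaV_smoothOn hU (e.smooth_frame c) (e.smooth_frame (I i))) hx

lemma deriv_act (hx : x ∈ U) {k : ℕ} {T : CovTensor M k} (hT : IsTensorial U T)
    (c : Fin 4) {A : M → Matrix (Fin 4) (Fin 4) ℝ} (hA : ∀ a b, FSmoothOn U (fun y ↦ A y a b))
    (I : Fin k → Fin 4) :
    deriv (e.frame c) (fun y ↦ act (A y) (e.comp T y) I) x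
      = act (fun a b ↦ deriv (e.frame c) (fun y ↦ A y a b) x) (e.comp T x) I
        + act (A x) (fun J ↦ deriv (e.frame c) (fun y ↦ e.comp T y J) x) I := by
  have hs : ∀ i b, FSmoothAt (fun y ↦ A y (I i) b * e.comp T y (Function.update I i b)) x :=
    fun i b ↦ (hA _ _ x hx).mul (e.comp_smooth hT _ x hx)
  simp only [act]
  rw [deriv_sum _ fun i _ ↦ FSmoothAt.sum fun b _ ↦ hs i b, ← Finset.sum_add_distrib]
  refine Finset.sum_congr rfl fun i _ ↦ ?_
  rw [deriv_sum _ fun b _ ↦ hs i b, ← Finset.sum_add_distrib]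
  exact Finset.sum_congr rfl fun b _ ↦ deriv_mul _ (hA _ _ x hx) (e.comp_smooth hT _ x hx)

lemma comp_nabla_nabla (hU : IsOpen U) (hx : x ∈ U) {k : ℕ} {T : CovTensor M k}
    (hT : IsTensorial U T) (c d : Fin 4) (I : Fin k → Fin 4) :
    e.comp (g.nabla (g.nabla T)) x (Fin.cons c (Fin.cons d I))
      = deriv (e.frame c) (deriv (e.frame d) (fun y ↦ e.comp T y I)) x
        - act (e.dΓ c d x) (e.comp T x) I
        - act (e.Γ d x) (fun J ↦ deriv (e.frame c) (fun y ↦ e.comp T y J) x) I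
        - ∑ f, e.Γ c x d f * e.comp (g.nabla T) x (Fin.cons f I)
        - act (e.Γ c x) (fun J ↦ deriv (e.frame d) (fun y ↦ e.comp T y J) x) I
        + act (e.Γ c x) (act (e.Γ d x) (e.comp T x)) I := by
  have hsm : ∀ i b, FSmoothAt (fun y ↦ e.Γ d y (I i) b * e.comp T y (Function.update I i b)) x :=
    fun i b ↦ (e.Γ_smooth hU _ _ _ x hx).mul (e.comp_smooth hT _ x hx)
  have h1 : deriv (e.frame c) (fun y ↦ e.comp (g.nabla T) y (Fin.cons d I)) x
      = deriv (e.frame c) (deriv (e.frame d) (fun y ↦ e.comp T y I)) x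
        - deriv (e.frame c) (fun y ↦ act (e.Γ d y) (e.comp T y) I) x := by
    rw [deriv_congr_on hU hx _ (fun y hy ↦ e.comp_nabla hU hy hT d I), deriv_sub]
    · exact e.deriv_smoothOn hU (e.smooth_frame d) (e.comp_smooth hT I) x hx
    · exact FSmoothAt.sum fun i _ ↦ FSmoothAt.sum fun b _ ↦ hsm i b
  have h3 := e.deriv_act hx hT c (fun a b ↦ e.Γ_smooth hU d a b) I
  change _ = act (e.dΓ c d x) _ _ + _ at h3
  rw [e.comp_nabla hU hx (e.isTensorial_nabla hU hT), h1, h3, act_cons]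
  have h2 : (fun J ↦ e.comp (g.nabla T) x (Fin.cons d J))
      = fun J ↦ deriv (e.frame d) (fun y ↦ e.comp T y J) x - act (e.Γ d x) (e.comp T x) J :=
    funext fun J ↦ e.comp_nabla hU hx hT d J
  rw [h2, act_sub_right]
  rw [show act (e.Γ c x) (fun J ↦ act (e.Γ d x) (e.comp T x) J) I
    = act (e.Γ c x) (act (e.Γ d x) (e.comp T x)) I from rfl]
  ring

lemma co_bracket (hU : IsOpen U) (hx : x ∈ U) (c d b : Fin 4) :
    e.co (bracket (e.frame c) (e.frame d)) b x = e.Γ c x d b - e.Γ d x c b := by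
  simp only [co, Γ, LorentzianMetric.ip]
  rw [← e.torsion_free hU hx (e.smooth_frame c x hx) (e.smooth_frame d x hx)]
  simp
  ring

lemma deriv_expand (hx : x ∈ U) (X : VField M) (f : M → ℝ) :
    deriv X f x = ∑ b, e.co X b x * deriv (e.frame b) f x := by
  rw [deriv_dir_congr (Y := fun y ↦ ∑ b, e.co X b y • e.frame b y) (e.expand hx X), deriv_dir_sum]
  exact Finset.sum_congr rfl fun b _ ↦ deriv_dir_smul _ _

/-- The coordinates of Y are pairings with the constant-Gram frame, so metric compatibility
differentiates them; skewness moves the derivative of the dual frame vector into `Γ`. -/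
lemma co_nablaV_right (hU : IsOpen U) (hx : x ∈ U) (c : Fin 4) {Y : VField M}
    (hY : Y.SmoothOn U) (b : Fin 4) :
    e.co (g.nablaV (e.frame c) Y) b x
      = deriv (e.frame c) (e.co Y b) x + ∑ a, e.co Y a x * e.Γ c x a b := by
  have hc := e.smooth_frame c x hx
  have hd := e.smooth_frame (dual b) x hx
  have h1 := e.metric_compat hU hx hc (hY x hx) hd
  have h2 : deriv (e.frame c) (e.co Y b) x
      = sgn b * deriv (e.frame c) (g.ip Y (e.frame (dual b))) x := by
    have := deriv_mul (e.frame c) (FSmoothAt.const (sgn b)) (g.ip_smooth (hY x hx) hd)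
    rw [deriv_const, zero_mul, zero_add] at this
    exact this
  have h3 : ∀ a, deriv (e.frame c) (g.ip (e.frame a) (e.frame (dual b))) x = 0 := fun a ↦ by
    rw [deriv_congr_on hU hx _ fun y hy ↦ e.ip_frame hy a (dual b), deriv_const]
  have h4 : ∀ a, g.ip (g.nablaV (e.frame c) (e.frame a)) (e.frame (dual b)) x
      = - g.ip (e.frame a) (g.nablaV (e.frame c) (e.frame (dual b))) x := fun a ↦ by
    have := e.metric_compat hU hx hc (e.smooth_frame a x hx) hd
    rw [h3] at this
    linarith
  have h5 : g.ip Y (g.nablaV (e.frame c) (e.frame (dual b))) x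
      = ∑ a, e.co Y a x * g.ip (e.frame a) (g.nablaV (e.frame c) (e.frame (dual b))) x := by
    simp only [LorentzianMetric.ip]
    conv_lhs => rw [e.expand hx Y]
    simp
  rw [h2, h1, h5]
  simp only [Γ, co, h4]
  rw [mul_add, Finset.mul_sum, add_assoc, ← Finset.sum_add_distrib]
  rw [Finset.sum_eq_zero fun a _ ↦ by ring, add_zero]

lemma co_nablaV_left (hU : IsOpen U) (hx : x ∈ U) {X : VField M} (hX : X.SmoothOn U)
    (a b : Fin 4) : e.co (g.nablaV X (e.frame a)) b x = ∑ c, e.co X c x * e.Γ c x a b := by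
  have ha := e.smooth_frame a x hx
  have h1 := e.torsion_free hU hx (hX x hx) ha
  have h : ∀ (s : Finset (Fin 4)) (f : Fin 4 → M → ℝ), (∀ c, FSmoothOn U (f c)) →
      g.nablaV (fun y ↦ ∑ c ∈ s, f c y • e.frame c y) (e.frame a) x
        = ∑ c ∈ s, f c x • g.nablaV (e.frame c) (e.frame a) x := by
    intro s f hf
    induction s using Finset.induction_on with
    | empty =>
      have := e.nablaV_smul_left hU hx (f := fun _ ↦ 0) ha (FSmoothAt.const 0) ha
      simpa using this
    | insert c s hc ih =>
      simp only [Finset.sum_insert hc]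
      rw [← ih, ← e.nablaV_smul_left hU hx (e.smooth_frame c x hx) (hf c x hx) ha]
      exact e.nablaV_add_left hU hx ((e.smooth_frame c x hx).smul (hf c x hx))
        (VField.SmoothAt.sum fun b _ ↦ (e.smooth_frame b x hx).smul (hf b x hx)) ha
  simp only [co, LorentzianMetric.ip]
  rw [g.nablaV_congr hU hx (X' := fun y ↦ ∑ c, e.co X c y • e.frame c y) (Y' := e.frame a)
    (fun y hy ↦ e.expand hy X) (fun _ _ ↦ rfl), h _ _ (e.co_expand_smooth hX)]
  simp only [map_sum, map_smul, sum_apply, smul_apply, smul_eq_mul, Finset.mul_sum, Γ, co,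
    LorentzianMetric.ip]
  exact Finset.sum_congr rfl fun c _ ↦ by ring

/-- Cartan's second structure equation. The commutator enters with a minus sign because coordinates
are stored in rows, which reverses the order of composition; the last sum is the bracket term,
rewritten with zero torsion. -/
lemma Rm_eq (hU : IsOpen U) (hx : x ∈ U) (c d : Fin 4) :
    e.Rm c d x = e.dΓ c d x - e.dΓ d c x - (e.Γ c x * e.Γ d x - e.Γ d x * e.Γ c x)
      - ∑ f, (e.Γ c x d f - e.Γ d x c f) • e.Γ f x := by
  ext a b
  have hn : ∀ c, (g.nablaV (e.frame c) (e.frame a)).SmoothOn U :=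
    fun c ↦ e.nablaV_smoothOn hU (e.smooth_frame c) (e.smooth_frame a)
  have hco : ∀ A B C : VField M, e.co (A - B - C) b x = e.co A b x - e.co B b x - e.co C b x := by
    intro A B C
    simp [co, LorentzianMetric.ip]
    ring
  simp only [Rm, LorentzianMetric.curvature]
  rw [hco, e.co_nablaV_right hU hx c (hn d), e.co_nablaV_right hU hx d (hn c),
    e.co_nablaV_left hU hx ((e.smooth_frame c).bracket (e.smooth_frame d))]
  simp only [e.co_bracket hU hx, Matrix.sub_apply, Matrix.mul_apply, Matrix.sum_apply,
    Matrix.smul_apply, smul_eq_mul]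
  simp only [dΓ, Γ]
  ring!

/-- The Ricci identity. -/
lemma ricci_identity (hU : IsOpen U) (hx : x ∈ U) {k : ℕ} {T : CovTensor M k}
    (hT : IsTensorial U T) (c d : Fin 4) (I : Fin k → Fin 4) :
    e.comp (g.nabla (g.nabla T)) x (Fin.cons c (Fin.cons d I))
      = e.comp (g.nabla (g.nabla T)) x (Fin.cons d (Fin.cons c I))
        - act (e.Rm c d x) (e.comp T x) I := by
  have h1 := e.deriv_commutator hU hx (e.smooth_frame c) (e.smooth_frame d) (e.comp_smooth hT I)
  rw [e.deriv_expand hx (bracket _ _)] at h1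
  have h2 := act_commutator (e.Γ c x) (e.Γ d x) (e.comp T x) I
  rw [e.comp_nabla_nabla hU hx hT, e.comp_nabla_nabla hU hx hT, e.Rm_eq hU hx, act_sub_left,
    act_sub_left, act_sub_left, act_sum_left, ← h2]
  -- By zero torsion, `Γ c d f - Γ d c f` are the coordinates of [e_c, e_d]. Hence the connection
  -- terms on the inner derivative slot match the bracket derivative together with the last sum of
  -- the structure equation.
  have h3 : ∑ f, e.Γ c x d f * e.comp (g.nabla T) x (Fin.cons f I)
      - ∑ f, e.Γ d x c f * e.comp (g.nabla T) x (Fin.cons f I)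
      = ∑ b, e.co (bracket (e.frame c) (e.frame d)) b x
          * deriv (e.frame b) (fun y ↦ e.comp T y I) x
        - ∑ f, act ((e.Γ c x d f - e.Γ d x c f) • e.Γ f x) (e.comp T x) I := by
    rw [← Finset.sum_sub_distrib, ← Finset.sum_sub_distrib]
    refine Finset.sum_congr rfl fun f _ ↦ ?_
    rw [e.comp_nabla hU hx hT, e.co_bracket hU hx, act_smul_left]
    ring
  linear_combination h1 - h3

end NPTetrad

end Kundt
end

/-! ### Boost grading, and two derivatives of a type D tensor under a reduced connection. -/

noncomputable section
namespace Kundt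

/-- Boost weights of the frame vectors. -/
def wt : Fin 4 → ℤ := ![1, -1, 0, 0]

lemma boostWeight_eq {k : ℕ} (I : Fin k → Fin 4) : boostWeight I = ∑ j, wt (I j) := rfl

lemma boostWeight_cons {k : ℕ} (c : Fin 4) (I : Fin k → Fin 4) :
    boostWeight (Fin.cons c I : Fin (k + 1) → Fin 4) = wt c + boostWeight I := by
  simp [boostWeight_eq, Fin.sum_univ_succ]

lemma boostWeight_update {k : ℕ} (I : Fin k → Fin 4) (i : Fin k) (b : Fin 4) :
    boostWeight (Function.update I i b) = boostWeight I + (wt b - wt (I i)) := by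
  rw [boostWeight_eq, boostWeight_eq, ← Finset.add_sum_erase _ _ (Finset.mem_univ i),
    ← Finset.add_sum_erase Finset.univ (fun j ↦ wt (I j)) (Finset.mem_univ i)]
  rw [Finset.sum_congr rfl fun j hj ↦ by rw [Function.update_of_ne (Finset.ne_of_mem_erase hj)],
    Function.update_self]
  ring

/-- The matrix `A` raises boost weights by `r`. -/
def HasDegree (r : ℤ) (A : Matrix (Fin 4) (Fin 4) ℝ) : Prop := ∀ a b, wt b - wt a ≠ r → A a b = 0

section degree

variable {k : ℕ} {r : ℤ} {A : Matrix (Fin 4) (Fin 4) ℝ} {t s : (Fin k → Fin 4) → ℝ}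
  {I : Fin k → Fin 4}

/-- A matrix of degree r only sees components whose weight is shifted by r. This is the basic
vanishing mechanism of the whole argument. -/
lemma HasDegree.act_congr (hA : HasDegree r A)
    (hts : ∀ J, boostWeight J = boostWeight I + r → t J = s J) : act A t I = act A s I := by
  refine Finset.sum_congr rfl fun i _ ↦ Finset.sum_congr rfl fun b _ ↦ ?_
  by_cases h : wt b - wt (I i) = r
  · rw [hts _ (by rw [boostWeight_update, h])]
  · rw [hA _ _ h, zero_mul, zero_mul]

lemma HasDegree.act_eq_zero (hA : HasDegree r A)
    (ht : ∀ J, boostWeight J = boostWeight I + r → t J = 0) : act A t I = 0 := by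
  rw [hA.act_congr (s := fun _ ↦ 0) ht]
  simp [act]

end degree

/-- Infinitesimal null rotations raising boost weights. -/
def raise (p q : ℝ) : Matrix (Fin 4) (Fin 4) ℝ :=
  !![0, 0, 0, 0; 0, 0, p, q; p, 0, 0, 0; q, 0, 0, 0]

/-- Infinitesimal null rotations lowering boost weights. -/
def lower (p q : ℝ) : Matrix (Fin 4) (Fin 4) ℝ :=
  !![0, 0, p, q; 0, 0, 0, 0; 0, p, 0, 0; 0, q, 0, 0]

/-- Infinitesimal boosts and rotations. -/
def spin (h θ : ℝ) : Matrix (Fin 4) (Fin 4) ℝ :=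
  !![h, 0, 0, 0; 0, -h, 0, 0; 0, 0, 0, θ; 0, 0, -θ, 0]

lemma hasDegree_raise (p q : ℝ) : HasDegree 1 (raise p q) := by
  intro a b
  fin_cases a <;> fin_cases b <;> simp [wt, raise]

lemma hasDegree_lower (p q : ℝ) : HasDegree (-1) (lower p q) := by
  intro a b
  fin_cases a <;> fin_cases b <;> simp [wt, lower]

lemma hasDegree_spin (h θ : ℝ) : HasDegree 0 (spin h θ) := by
  intro a b
  fin_cases a <;> fin_cases b <;> simp [wt, spin]

lemma raise_zero : raise 0 0 = 0 := by
  ext a b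
  fin_cases a <;> fin_cases b <;> simp [raise]

lemma lower_zero : lower 0 0 = 0 := by
  ext a b
  fin_cases a <;> fin_cases b <;> simp [lower]

lemma spin_zero : spin 0 0 = 0 := by
  ext a b
  fin_cases a <;> fin_cases b <;> simp [spin]

/-- The boost part scales a lowering null rotation and is compensated by the extra term; the
rotation part turns its parameter. That rotation becomes the term (γ - γ̄)τ. -/
lemma lower_commutator_spin (p q h θ : ℝ) :
    lower p q * spin h θ - spin h θ * lower p q + h • lower p q = lower (-(θ * q)) (θ * p) := by
  ext a b
  fin_cases a <;> fin_cases b <;>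
    simp [lower, spin] <;> ring

lemma lower_add (p q p' q' : ℝ) : lower p q + lower p' q' = lower (p + p') (q + q') := by
  ext a b
  fin_cases a <;> fin_cases b <;> simp [lower]

variable {M : Type*} [TopologicalSpace M] [ChartedSpace R4 M] [IsManifold (𝓡 4) ∞ M]

namespace NPTetrad

variable {g : LorentzianMetric M} {U : Set M} (e : NPTetrad g U) {x : M}

lemma IsTypeD.comp_eq_zero {e : NPTetrad g U} {k : ℕ} {T : CovTensor M k} (hT : e.IsTypeD T)
    {I : Fin k → Fin 4} (hI : boostWeight I ≠ 0) (hx : x ∈ U) : e.comp T x I = 0 := hT I hI x hx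

lemma IsTypeD.deriv_comp {e : NPTetrad g U} (hU : IsOpen U) {k : ℕ} {T : CovTensor M k}
    (hT : e.IsTypeD T) {I : Fin k → Fin 4} (hI : boostWeight I ≠ 0) (hx : x ∈ U) (X : VField M) :
    deriv X (fun y ↦ e.comp T y I) x = 0 :=
  deriv_eq_zero_of_eventually X
    (Filter.eventually_of_mem (hU.mem_nhds hx) fun _ hy ↦ hT.comp_eq_zero hI hy)

lemma wt_dual (b : Fin 4) : wt (dual b) = - wt b := by fin_cases b <;> simp [wt, dual]

/-- Lowering the index b replaces it by `dual b`, of opposite weight, so the grading of the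
curvature matrices is exactly the type D condition on Riem. -/
lemma hasDegree_Rm (hD : e.IsTypeD g.riem) (hx : x ∈ U) (c d : Fin 4) :
    HasDegree (wt c + wt d) (e.Rm c d x) := by
  intro a b h
  have h1 := hD.comp_eq_zero (I := ![dual b, a, c, d]) (by
    simp only [boostWeight_eq, Fin.sum_univ_four]
    simp [wt_dual]
    contrapose! h
    linarith) hx
  have h2 : e.comp g.riem x ![dual b, a, c, d]
      = g.ip (g.curvature (e.frame c) (e.frame d) (e.frame a)) (e.frame (dual b)) x := by
    rw [g.ip_comm]; rfl
  rw [h2] at h1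
  simp [Rm, co, h1]

/-- The connection of a tetrad in which a degenerate Kundt spacetime takes its canonical form. -/
structure IsReduced : Prop where
  zero : ∀ y ∈ U, e.Γ 0 y = raise (e.Γ 0 y 1 2) (e.Γ 0 y 1 3)
  one : ∀ y ∈ U, e.Γ 1 y = spin (e.Γ 1 y 0 0) (e.Γ 1 y 2 3) + lower (e.Γ 1 y 0 2) (e.Γ 1 y 0 3)
  two : ∀ y ∈ U, e.Γ 2 y = spin (e.Γ 2 y 0 0) (e.Γ 2 y 2 3)
  three : ∀ y ∈ U, e.Γ 3 y = spin (e.Γ 3 y 0 0) (e.Γ 3 y 2 3)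

variable {e}

section step

variable {k : ℕ} {T : CovTensor M k}

/-- The derivative term dies because T is type D. A connection part can reach weight 0 only by
raising weight -1 along ℓ or lowering weight 1 along n, the two excluded cases. -/
lemma IsReduced.comp_nabla_eq_zero (he : e.IsReduced) (hU : IsOpen U) (hT : IsTensorial U T)
    (hD : e.IsTypeD T) (hx : x ∈ U) (c : Fin 4) {I : Fin k → Fin 4} (hI : boostWeight I ≠ 0)
    (h0 : c = 0 → boostWeight I ≠ -1) (h1 : c = 1 → boostWeight I ≠ 1) :
    e.comp (g.nabla T) x (Fin.cons c I) = 0 := by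
  have hs : ∀ h θ, act (spin h θ) (e.comp T x) I = 0 := fun h θ ↦
    (hasDegree_spin h θ).act_eq_zero fun J hJ ↦ hD.comp_eq_zero (by simpa [hJ] using hI) hx
  rw [e.comp_nabla hU hx hT, hD.deriv_comp hU hI hx, zero_sub, neg_eq_zero]
  fin_cases c
  · simp only [Fin.zero_eta]
    rw [he.zero x hx]
    refine (hasDegree_raise _ _).act_eq_zero fun J hJ ↦ hD.comp_eq_zero ?_ hx
    have := h0 rfl
    omega
  · simp only [Fin.mk_one]
    rw [he.one x hx, act_add_left, hs, zero_add]
    refine (hasDegree_lower _ _).act_eq_zero fun J hJ ↦ hD.comp_eq_zero ?_ hx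
    have := h1 rfl
    omega
  · change act (e.Γ 2 x) _ _ = 0
    rw [he.two x hx, hs]
  · change act (e.Γ 3 x) _ _ = 0
    rw [he.three x hx, hs]

/-- The curvature correction reads T at the total weight of the component, where T vanishes. -/
lemma comp_ricci (hU : IsOpen U) (hR : e.IsTypeD g.riem) (hT : IsTensorial U T) (hD : e.IsTypeD T)
    (hx : x ∈ U) (c d : Fin 4) {I : Fin k → Fin 4} (hI : wt c + wt d + boostWeight I ≠ 0) :
    e.comp (g.nabla (g.nabla T)) x (Fin.cons c (Fin.cons d I))
      = e.comp (g.nabla (g.nabla T)) x (Fin.cons d (Fin.cons c I)) := by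
  rw [e.ricci_identity hU hx hT, (e.hasDegree_Rm hR hx c d).act_eq_zero, sub_zero]
  intro J hJ
  exact hD.comp_eq_zero (by omega) hx

/-- Since ∇T is type D, ℓ annihilates all components of T, and the outer connection term reads ∇T at
weight 1, where it vanishes. Only the derivative of the null rotation in `Γ 0` remains. -/
lemma IsReduced.comp_zero_zero (he : e.IsReduced) (hU : IsOpen U) (hT : IsTensorial U T)
    (hD : e.IsTypeD T) (hD' : e.IsTypeD (g.nabla T)) (hx : x ∈ U) {I : Fin k → Fin 4}
    (hI : boostWeight I = -1) :
    e.comp (g.nabla (g.nabla T)) x (Fin.cons 0 (Fin.cons 0 I))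
      = - act (raise (deriv e.l (fun y ↦ e.Γ 0 y 1 2) x) (deriv e.l (fun y ↦ e.Γ 0 y 1 3) x))
          (e.comp T x) I := by
  have h1 : act (e.Γ 0 x) (e.comp (g.nabla T) x) (Fin.cons 0 I) = 0 := by
    rw [he.zero x hx]
    refine (hasDegree_raise _ _).act_eq_zero fun J hJ ↦ hD'.comp_eq_zero ?_ hx
    simp [hJ, boostWeight_cons, wt, hI]
  have h2 : ∀ y ∈ U, e.comp (g.nabla T) y (Fin.cons 0 I)
      = - act (raise (e.Γ 0 y 1 2) (e.Γ 0 y 1 3)) (e.comp T y) I := by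
    intro y hy
    rw [e.comp_nabla hU hy hT, hD.deriv_comp hU (by simp [hI]) hy, ← he.zero y hy, zero_sub]
  have h3 : ∀ J, deriv (e.frame 0) (fun y ↦ e.comp T y J) x = 0 := by
    intro J
    by_cases hJ : boostWeight J = 0
    · have h4 := e.comp_nabla hU hx hT 0 J
      rw [hD'.comp_eq_zero (by simp [boostWeight_cons, wt, hJ]) hx, he.zero x hx,
        (hasDegree_raise _ _).act_eq_zero fun J' hJ' ↦ hD.comp_eq_zero (by omega) hx] at h4
      linarith
    · exact hD.deriv_comp hU hJ hx _
  have h5 := e.deriv_act hx hT 0 (A := fun y ↦ raise (e.Γ 0 y 1 2) (e.Γ 0 y 1 3)) (fun a b ↦ by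
    have hc : FSmoothOn U fun _ : M ↦ (0 : ℝ) := FSmoothOn.const 0
    fin_cases a <;> fin_cases b <;> simp [raise, hc, e.Γ_smooth hU]) I
  have h6 : (fun a b ↦ deriv (e.frame 0) (fun y ↦ raise (e.Γ 0 y 1 2) (e.Γ 0 y 1 3) a b) x)
      = raise (deriv e.l (fun y ↦ e.Γ 0 y 1 2) x) (deriv e.l (fun y ↦ e.Γ 0 y 1 3) x) := by
    ext a b
    fin_cases a <;> fin_cases b <;> simp [raise, deriv_const] <;> rfl
  rw [e.comp_nabla hU hx (e.isTensorial_nabla hU hT), h1, deriv_congr_on hU hx _ h2, deriv_neg, h5,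
    h6]
  simp [h3, act]

/-- Write Γ₁ = P + L with P the spin and L the lowering part. Now n acts on weight 0 components of T
through P, so besides the derivative of L there appear the commutator [L, P] and a boost term from
the derivative slot; `lower_commutator_spin` merges them into one null rotation. -/
lemma IsReduced.comp_one_one (he : e.IsReduced) (hU : IsOpen U) (hT : IsTensorial U T)
    (hD : e.IsTypeD T) (hD' : e.IsTypeD (g.nabla T)) (hx : x ∈ U) {I : Fin k → Fin 4}
    (hI : boostWeight I = 1) :
    e.comp (g.nabla (g.nabla T)) x (Fin.cons 1 (Fin.cons 1 I))
      = - act (lower (deriv e.n (fun y ↦ e.Γ 1 y 0 2) x - e.Γ 1 x 2 3 * e.Γ 1 x 0 3)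
          (deriv e.n (fun y ↦ e.Γ 1 y 0 3) x + e.Γ 1 x 2 3 * e.Γ 1 x 0 2)) (e.comp T x) I := by
  set P := spin (e.Γ 1 x 0 0) (e.Γ 1 x 2 3) with hP
  set L : M → Matrix (Fin 4) (Fin 4) ℝ := fun y ↦ lower (e.Γ 1 y 0 2) (e.Γ 1 y 0 3) with hL
  have hΓ : e.Γ 1 x = P + L x := he.one x hx
  have h2 : ∀ y ∈ U, ∀ J : Fin k → Fin 4, boostWeight J = 1 →
      e.comp (g.nabla T) y (Fin.cons 1 J) = - act (L y) (e.comp T y) J := by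
    intro y hy J hJ
    rw [e.comp_nabla hU hy hT, hD.deriv_comp hU (by simp [hJ]) hy, he.one y hy, act_add_left,
      (hasDegree_spin _ _).act_eq_zero fun J' hJ' ↦ hD.comp_eq_zero (by omega) hy]
    ring
  have h3 : ∀ J : Fin k → Fin 4, boostWeight J = 0 →
      deriv (e.frame 1) (fun y ↦ e.comp T y J) x = act P (e.comp T x) J := by
    intro J hJ
    have h4 := e.comp_nabla hU hx hT 1 J
    rw [hD'.comp_eq_zero (by simp [boostWeight_cons, wt, hJ]) hx, hΓ, act_add_left,
      (hasDegree_lower _ _).act_eq_zero fun J' hJ' ↦ hD.comp_eq_zero (by omega) hx] at h4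
    linarith
  have h1 : act (e.Γ 1 x) (e.comp (g.nabla T) x) (Fin.cons 1 I)
      = e.Γ 1 x 0 0 * act (L x) (e.comp T x) I - act P (act (L x) (e.comp T x)) I := by
    have hL0 : act (L x) (fun J ↦ e.comp (g.nabla T) x (Fin.cons 1 J)) I = 0 :=
      (hasDegree_lower _ _).act_eq_zero fun J hJ ↦ hD'.comp_eq_zero
        (by simp [boostWeight_cons, wt, hJ, hI]) hx
    have hP0 : act P (fun J ↦ e.comp (g.nabla T) x (Fin.cons 1 J)) I
        = act P (fun J ↦ - act (L x) (e.comp T x) J) I :=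
      (hasDegree_spin _ _).act_congr fun J hJ ↦ h2 x hx J (by omega)
    -- In Γ₁ the row of n has only its boost entry, so the derivative slot contributes a multiple of
    -- the same component; this is the term that cancels the boost in [L, P].
    have hrow : ∀ f, e.Γ 1 x 1 f = if f = 1 then - e.Γ 1 x 0 0 else 0 := fun f ↦ by
      have h := congrFun (congrFun (he.one x hx) 1) f
      rw [h]
      fin_cases f <;> simp [spin, lower]
    have hact : act (e.Γ 1 x) (fun J ↦ e.comp (g.nabla T) x (Fin.cons 1 J)) I
        = - act P (act (L x) (e.comp T x)) I := by
      rw [hΓ, act_add_left, hL0, hP0, act_neg_right, add_zero]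
    rw [act_cons, hact]
    simp [hrow, h2 x hx I hI]
    ring
  have h5 := e.deriv_act hx hT 1 (A := L) (fun a b ↦ by
    have hc : FSmoothOn U fun _ : M ↦ (0 : ℝ) := FSmoothOn.const 0
    fin_cases a <;> fin_cases b <;> simp [hL, lower, hc, e.Γ_smooth hU]) I
  have h6 : (fun a b ↦ deriv (e.frame 1) (fun y ↦ L y a b) x)
      = lower (deriv e.n (fun y ↦ e.Γ 1 y 0 2) x) (deriv e.n (fun y ↦ e.Γ 1 y 0 3) x) := by
    ext a b
    fin_cases a <;> fin_cases b <;> simp [hL, lower, deriv_const] <;> rfl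
  have h7 : act (L x) (fun J ↦ deriv (e.frame 1) (fun y ↦ e.comp T y J) x) I
      = act (L x) (act P (e.comp T x)) I :=
    (hasDegree_lower _ _).act_congr fun J hJ ↦ h3 J (by omega)
  have h8 := act_commutator (L x) P (e.comp T x) I
  have h9 := lower_commutator_spin (e.Γ 1 x 0 2) (e.Γ 1 x 0 3) (e.Γ 1 x 0 0) (e.Γ 1 x 2 3)
  rw [e.comp_nabla hU hx (e.isTensorial_nabla hU hT), h1,
    deriv_congr_on hU hx _ fun y hy ↦ h2 y hy I hI, deriv_neg, h5, h6, h7,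
    sub_eq_add_neg (deriv e.n _ x), ← lower_add, ← h9, act_add_left, act_add_left, ← h8,
    act_smul_left]
  ring

/-- If the inner block (d, I) has nonzero weight, the one-step vanishing lemma applied to ∇T
suffices. Otherwise c has nonzero weight: for c ≠ d the derivative slots are exchanged, which gives
the inner block nonzero weight, and c = d leaves exactly the two families assumed to vanish. -/
lemma IsReduced.isTypeD_nabla_nabla (he : e.IsReduced) (hU : IsOpen U) (hR : e.IsTypeD g.riem)
    (hT : IsTensorial U T) (hD : e.IsTypeD T) (hD' : e.IsTypeD (g.nabla T))
    (h0 : ∀ x ∈ U, ∀ I : Fin k → Fin 4, boostWeight I = -1 →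
      e.comp (g.nabla (g.nabla T)) x (Fin.cons 0 (Fin.cons 0 I)) = 0)
    (h1 : ∀ x ∈ U, ∀ I : Fin k → Fin 4, boostWeight I = 1 →
      e.comp (g.nabla (g.nabla T)) x (Fin.cons 1 (Fin.cons 1 I)) = 0) :
    e.IsTypeD (g.nabla (g.nabla T)) := by
  have hT' := e.isTensorial_nabla hU hT
  intro I hI x hx
  change e.comp (g.nabla (g.nabla T)) x I = 0
  obtain ⟨c, J, rfl⟩ : ∃ c J, I = Fin.cons c J := ⟨I 0, Fin.tail I, (Fin.cons_self_tail I).symm⟩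
  obtain ⟨d, I, rfl⟩ : ∃ d I, J = Fin.cons d I := ⟨J 0, Fin.tail J, (Fin.cons_self_tail J).symm⟩
  rw [boostWeight_cons, boostWeight_cons] at hI
  have key : ∀ c d : Fin 4, wt c + (wt d + boostWeight I) ≠ 0 → wt d + boostWeight I ≠ 0 →
      (c = 0 → wt d + boostWeight I ≠ -1) → (c = 1 → wt d + boostWeight I ≠ 1) →
      e.comp (g.nabla (g.nabla T)) x (Fin.cons c (Fin.cons d I)) = 0 := by
    intro c d h hJ hc0 hc1
    exact he.comp_nabla_eq_zero hU hT' hD' hx c (by rwa [boostWeight_cons])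
      (by rwa [boostWeight_cons]) (by rwa [boostWeight_cons])
  by_cases hJ : wt d + boostWeight I = 0
  · by_cases hcd : c = d
    · subst hcd
      by_cases hc0 : c = 0
      · subst hc0
        exact h0 x hx I (by simp [wt] at hJ; omega)
      by_cases hc1 : c = 1
      · subst hc1
        exact h1 x hx I (by simp [wt] at hJ; omega)
      · fin_cases c <;> simp [wt] at * <;> omega
    · rw [comp_ricci hU hR hT hD hx c d (by omega)]
      have hc : wt c ≠ 0 := by omega
      have hne : wt c ≠ wt d := by
        have : ∀ c d : Fin 4, wt c ≠ 0 → c ≠ d → wt c ≠ wt d := by decide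
        exact this c d hc hcd
      apply key
      · omega
      · omega
      all_goals
        rintro rfl h
        have h0 : wt 0 = 1 := rfl
        have h1 : wt 1 = -1 := rfl
        omega
  · apply key _ _ hI hJ
    all_goals
      rintro rfl h
      rw [h] at hI
      exact hI rfl

end step

end NPTetrad

end Kundt
end

/-! ### Algebra of curvature tensors annihilated by null rotations. -/

noncomputable section
namespace Kundt

/-- The algebraic symmetries of the Riemann tensor. -/
structure CurvatureLike (r : Fin 4 → Fin 4 → Fin 4 → Fin 4 → ℝ) : Prop where
  skew_left : ∀ a b c d, r a b c d = - r b a c d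
  skew_right : ∀ a b c d, r a b c d = - r a b d c
  cyclic : ∀ a b c d, r a b c d + r a c d b + r a d b c = 0

namespace CurvatureLike

variable {r : Fin 4 → Fin 4 → Fin 4 → Fin 4 → ℝ}

lemma pair (hr : CurvatureLike r) (a b c d : Fin 4) : r a b c d = r c d a b := by
  have h1 := hr.cyclic a b c d
  have h2 := hr.cyclic b c d a
  have h3 := hr.cyclic c d a b
  have h4 := hr.cyclic d a b c
  have e1 := hr.skew_left b c d a
  have e2 := hr.skew_right c b d a
  have e3 := hr.skew_left b d a c
  have e4 := hr.skew_left b a c d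
  have e5 := hr.skew_left c a b d
  have e6 := hr.skew_right a c b d
  have e7 := hr.skew_left d a b c
  have e8 := hr.skew_left d b c a
  have e9 := hr.skew_right b d c a
  have e10 := hr.skew_left d c a b
  linarith

lemma diag_left (hr : CurvatureLike r) (a c d : Fin 4) : r a a c d = 0 := by
  have := hr.skew_left a a c d; linarith

lemma diag_right (hr : CurvatureLike r) (a b c : Fin 4) : r a b c c = 0 := by
  have := hr.skew_right a b c c; linarith

end CurvatureLike

/-- Reduces the weight 0 components to the six R₀₁₀₁, R₂₃₂₃, R₀₂₁₂, R₀₂₁₃, R₀₃₁₂, R₀₃₁₃, in which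
the null rotation system is written. -/
lemma CurvatureLike.normal_forms {r : Fin 4 → Fin 4 → Fin 4 → Fin 4 → ℝ} (hr : CurvatureLike r) :
    (r 1 0 1 0 = r 0 1 0 1 ∧ r 1 2 0 2 = r 0 2 1 2 ∧ r 1 3 0 3 = r 0 3 1 3) ∧
    (r 1 2 0 3 = r 0 3 1 2 ∧ r 1 3 0 2 = r 0 2 1 3 ∧ r 0 1 2 3 = r 0 2 1 3 - r 0 3 1 2) := by
  have sr := hr.skew_right 0 2 1 3
  refine ⟨⟨?_, hr.pair _ _ _ _, hr.pair _ _ _ _⟩, hr.pair _ _ _ _, hr.pair _ _ _ _, ?_⟩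
  · rw [hr.skew_left, hr.skew_right, neg_neg]
  · have := hr.cyclic 0 1 2 3
    linarith

lemma act_four (A : Matrix (Fin 4) (Fin 4) ℝ) (t : (Fin 4 → Fin 4) → ℝ) (a b c d : Fin 4) :
    act A t ![a, b, c, d] = ∑ f, (A a f * t ![f, b, c, d] + A b f * t ![a, f, c, d]
      + A c f * t ![a, b, f, d] + A d f * t ![a, b, c, f]) := by
  have h0 : ∀ f, Function.update ![a, b, c, d] 0 f = ![f, b, c, d] := fun f ↦ by
    ext j; fin_cases j <;> simp [Function.update]
  have h1 : ∀ f, Function.update ![a, b, c, d] 1 f = ![a, f, c, d] := fun f ↦ by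
    ext j; fin_cases j <;> simp [Function.update]
  have h2 : ∀ f, Function.update ![a, b, c, d] 2 f = ![a, b, f, d] := fun f ↦ by
    ext j; fin_cases j <;> simp [Function.update]
  have h3 : ∀ f, Function.update ![a, b, c, d] 3 f = ![a, b, c, f] := fun f ↦ by
    ext j; fin_cases j <;> simp [Function.update]
  simp only [act, Fin.sum_univ_four (f := fun i : Fin 4 ↦ _), h0, h1, h2, h3]
  simp
  ring

/-- The linear system satisfied by a null rotation that annihilates the Riemann tensor. -/
lemma null_rotation_eq_zero {A K a b c d p q : ℝ}
    (h1 : A * p - a * p - c * q + (b - c) * q = 0) (h2 : A * q - b * p - d * q - (b - c) * p = 0)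
    (h3 : K * q + (b - c) * p - p * c + q * a = 0) (h4 : K * p - (b - c) * q + p * d - q * b = 0)
    (hnd : (A - K - a - d) ^ 2 + 9 * (b - c) ^ 2 ≠ 0 ∨ ((A - K - a - d) ^ 2 + 9 * (b - c) ^ 2 = 0 ∧
      (A - a) * (A - d) - ((b + c) / 2) ^ 2 ≠ 0)) : p = 0 ∧ q = 0 := by
  -- The differences of the equations isolate the Weyl part: together they say that (u - 3iv)(p +
  -- iq) = 0 with u = A - K - a - d and v = b - c, and u² + 9v² is the determinant.
  have k1 : (A - K - a - d) * p + 3 * (b - c) * q = 0 := by linarith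
  have k2 : (A - K - a - d) * q - 3 * (b - c) * p = 0 := by linarith
  rcases hnd with h | ⟨h, h'⟩
  · constructor
    · refine (mul_eq_zero.1 (?_ : ((A - K - a - d) ^ 2 + 9 * (b - c) ^ 2) * p = 0)).resolve_left h
      linear_combination (A - K - a - d) * k1 - 3 * (b - c) * k2
    · refine (mul_eq_zero.1 (?_ : ((A - K - a - d) ^ 2 + 9 * (b - c) ^ 2) * q = 0)).resolve_left h
      linear_combination 3 * (b - c) * k1 + (A - K - a - d) * k2
  -- Without Weyl part, the first two equations form a symmetric 2×2 system in p, q whose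
  -- determinant is the second nondegeneracy quantity.
  · have hbc : b - c = 0 := by
      have : (b - c) ^ 2 = 0 := by nlinarith [sq_nonneg (A - K - a - d), sq_nonneg (b - c)]
      exact pow_eq_zero_iff two_ne_zero |>.1 this
    obtain rfl : b = c := by linarith
    constructor
    · refine (mul_eq_zero.1 (?_ : ((A - a) * (A - d) - ((b + b) / 2) ^ 2) * p = 0)).resolve_left h'
      linear_combination (A - d) * h1 + b * h2
    · refine (mul_eq_zero.1 (?_ : ((A - a) * (A - d) - ((b + b) / 2) ^ 2) * q = 0)).resolve_left h'
      linear_combination b * h1 + (A - a) * h2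

/-- The Riemann tensor is not invariant under any null rotation. -/
def Nondegenerate (r : Fin 4 → Fin 4 → Fin 4 → Fin 4 → ℝ) : Prop :=
  (r 0 1 0 1 - r 2 3 2 3 - r 0 2 1 2 - r 0 3 1 3) ^ 2 + 9 * (r 0 2 1 3 - r 0 3 1 2) ^ 2 ≠ 0 ∨
  ((r 0 1 0 1 - r 2 3 2 3 - r 0 2 1 2 - r 0 3 1 3) ^ 2 + 9 * (r 0 2 1 3 - r 0 3 1 2) ^ 2 = 0 ∧
    (r 0 1 0 1 - r 0 2 1 2) * (r 0 1 0 1 - r 0 3 1 3) - ((r 0 2 1 3 + r 0 3 1 2) / 2) ^ 2 ≠ 0)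

section annihilator

variable {t : (Fin 4 → Fin 4) → ℝ} (hr : CurvatureLike fun a b c d ↦ t ![a, b, c, d])
  (hnd : Nondegenerate fun a b c d ↦ t ![a, b, c, d]) {p q : ℝ}

include hr hnd

/-- Four components of weight -1 suffice; a raising action reads only the weight 0 part of t there,
so t itself need not be type D. -/
lemma raise_eq_zero (h : ∀ I : Fin 4 → Fin 4, boostWeight I = -1 → act (raise p q) t I = 0) :
    p = 0 ∧ q = 0 := by
  have h1 := h ![1, 0, 1, 2] (by simp [boostWeight_eq, Fin.sum_univ_four, wt])
  have h2 := h ![1, 0, 1, 3] (by simp [boostWeight_eq, Fin.sum_univ_four, wt])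
  have h3 := h ![1, 2, 2, 3] (by simp [boostWeight_eq, Fin.sum_univ_four, wt])
  have h4 := h ![1, 3, 2, 3] (by simp [boostWeight_eq, Fin.sum_univ_four, wt])
  rw [act_four, Fin.sum_univ_four] at h1 h2 h3 h4
  simp [raise] at h1 h2 h3 h4
  obtain ⟨⟨e1, e2, e3⟩, e4, e5, e6⟩ := hr.normal_forms
  have sl := hr.skew_left
  have sr := hr.skew_right
  have dl := hr.diag_left
  have dr := hr.diag_right
  simp only [dl, dr, e1, e2, e3, e4, e5, e6, sl 2 0, sl 3 0, sl 1 0 2 3, sr 1 0 3 2, sr 1 2 2 0,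
    sr 1 3 2 0, sl 3 2] at h1 h2 h3 h4
  refine null_rotation_eq_zero ?_ ?_ ?_ ?_ hnd <;> dsimp only <;> linarith

lemma lower_eq_zero (h : ∀ I : Fin 4 → Fin 4, boostWeight I = 1 → act (lower p q) t I = 0) :
    p = 0 ∧ q = 0 := by
  have h1 := h ![0, 1, 0, 2] (by simp [boostWeight_eq, Fin.sum_univ_four, wt])
  have h2 := h ![0, 1, 0, 3] (by simp [boostWeight_eq, Fin.sum_univ_four, wt])
  have h3 := h ![0, 2, 2, 3] (by simp [boostWeight_eq, Fin.sum_univ_four, wt])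
  have h4 := h ![0, 3, 2, 3] (by simp [boostWeight_eq, Fin.sum_univ_four, wt])
  rw [act_four, Fin.sum_univ_four] at h1 h2 h3 h4
  simp [lower] at h1 h2 h3 h4
  obtain ⟨⟨-, e2, e3⟩, e4, e5, e6⟩ := hr.normal_forms
  have sl := hr.skew_left
  have sr := hr.skew_right
  have dl := hr.diag_left
  have dr := hr.diag_right
  simp only [dl, dr, e2, e3, e4, e5, e6, sl 2 1, sl 3 1, sr 0 1 3 2, sr 0 2 2 1,
    sr 0 3 2 1, sl 3 2] at h1 h2 h3 h4
  simp only [Nondegenerate] at hnd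
  -- Exchanging ℓ and n exchanges the roles of R₀₂₁₃ and R₀₃₁₂, under which the nondegeneracy
  -- condition is symmetric.
  refine null_rotation_eq_zero (A := t ![0, 1, 0, 1]) (K := t ![2, 3, 2, 3]) (a := t ![0, 2, 1, 2])
    (b := t ![0, 3, 1, 2]) (c := t ![0, 2, 1, 3]) (d := t ![0, 3, 1, 3]) ?_ ?_ ?_ ?_ ?_
  iterate 4 linarith
  rwa [← neg_sub (t ![0, 2, 1, 3]), neg_sq, add_comm (t ![0, 3, 1, 2])]

end annihilator

end Kundt
end

/-! ### Translation of the Newman–Penrose scalars into real frame components. -/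

noncomputable section
namespace Kundt

lemma sq_add_nine_mul_sq_eq_zero {u v : ℝ} : u ^ 2 + 9 * v ^ 2 = 0 ↔ u = 0 ∧ v = 0 := by
  constructor
  · intro h
    constructor <;> nlinarith [sq_nonneg u, sq_nonneg v]
  · rintro ⟨rfl, rfl⟩
    norm_num

namespace NPTetrad

/-- The complex number `1 / √2`. -/
def isq : ℂ := 1 / (Real.sqrt 2 : ℂ)

lemma isq_mul_self : isq * isq = 1 / 2 := by
  have h : (Real.sqrt 2 : ℂ) * (Real.sqrt 2 : ℂ) = 2 := by
    rw [← Complex.ofReal_mul, Real.mul_self_sqrt (by norm_num)]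
    simp
  rw [isq, div_mul_div_comm, h, one_mul]

lemma isq_ne_zero : isq ≠ 0 := fun h ↦ by
  have := isq_mul_self
  simp [h] at this

lemma cm_eq : cm = ![0, 0, isq, Complex.I * isq] := by
  simp [cm, isq, div_eq_mul_inv]

lemma cmb_eq : cmb = ![0, 0, isq, -(Complex.I * isq)] := by
  simp [cmb, isq, div_eq_mul_inv]

section ext

variable (F : Fin 4 → Fin 4 → ℝ) (G : Fin 4 → Fin 4 → Fin 4 → ℝ)
  (H : Fin 4 → Fin 4 → Fin 4 → Fin 4 → ℝ) (u : Fin 4 → ℂ) (a : Fin 4)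

lemma sum_pair_m_mb {A : Fin 4 → Fin 4 → ℂ} :
    ∑ i, ∑ j, cm i * cmb j * A i j
      = ((A 2 2 + A 3 3) + Complex.I * (A 3 2 - A 2 3)) / 2 := by
  simp only [cm_eq, cmb_eq, Fin.sum_univ_four]
  simp
  linear_combination (A 2 2 - Complex.I ^ 2 * A 3 3 + Complex.I * (A 3 2 - A 2 3)) * isq_mul_self
    - A 3 3 / 2 * Complex.I_sq

lemma sum_pair_m_m {A : Fin 4 → Fin 4 → ℂ} :
    ∑ i, ∑ j, cm i * cm j * A i j
      = ((A 2 2 - A 3 3) + Complex.I * (A 3 2 + A 2 3)) / 2 := by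
  simp only [cm_eq, Fin.sum_univ_four]
  simp
  linear_combination (A 2 2 + Complex.I ^ 2 * A 3 3 + Complex.I * (A 3 2 + A 2 3)) * isq_mul_self
    + A 3 3 / 2 * Complex.I_sq

lemma sum_pair_mb_mb {A : Fin 4 → Fin 4 → ℂ} :
    ∑ i, ∑ j, cmb i * cmb j * A i j
      = ((A 2 2 - A 3 3) - Complex.I * (A 3 2 + A 2 3)) / 2 := by
  simp only [cmb_eq, Fin.sum_univ_four]
  simp
  linear_combination (A 2 2 + Complex.I ^ 2 * A 3 3 - Complex.I * (A 3 2 + A 2 3)) * isq_mul_self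
    + A 3 3 / 2 * Complex.I_sq

lemma ext₂_l_n : ext₂ F cl cn = F 0 1 := by
  simp [ext₂, cl, cn, Fin.sum_univ_four]

lemma ext₃_m_mb (c : Fin 4) (w : Fin 4 → ℂ) (hw : ∀ d, w d = if d = c then 1 else 0) :
    ext₃ G cm cmb w
      = ((G 2 2 c + G 3 3 c : ℂ) + Complex.I * (G 3 2 c - G 2 3 c)) / 2 := by
  rw [← sum_pair_m_mb (A := fun i j ↦ (G i j c : ℂ))]
  simp [ext₃, hw]

lemma ext₃_basis (c : Fin 4) (v w : Fin 4 → ℂ) (hw : ∀ d, w d = if d = c then 1 else 0)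
    (hu : ∀ d, u d = if d = a then 1 else 0) :
    ext₃ G u v w = ∑ b, v b * (G a b c : ℂ) := by
  simp [ext₃, hw, hu]

lemma cl_apply (d : Fin 4) : cl d = if d = 0 then 1 else 0 := by fin_cases d <;> simp [cl]

lemma cn_apply (d : Fin 4) : cn d = if d = 1 then 1 else 0 := by fin_cases d <;> simp [cn]

end ext

variable {M : Type*} [TopologicalSpace M] [ChartedSpace R4 M] [IsManifold (𝓡 4) ∞ M]
variable {g : LorentzianMetric M} {U : Set M} (e : NPTetrad g U) {x : M}

lemma conn_eq (x : M) (a b c : Fin 4) : e.conn x a b c = sgn b * e.Γ c x a (dual b) := by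
  simp only [conn, Γ, co, dual_dual, sgn_dual]
  rw [← mul_assoc, sgn_mul_self, one_mul]

lemma conn_skew (hU : IsOpen U) (hx : x ∈ U) (a b c : Fin 4) :
    e.conn x a b c = - e.conn x b a c := by
  have h1 := e.metric_compat hU hx (e.smooth_frame c x hx) (e.smooth_frame a x hx)
    (e.smooth_frame b x hx)
  rw [deriv_congr_on hU hx _ fun y hy ↦ e.ip_frame hy a b, deriv_const,
    g.ip_comm (e.frame a)] at h1
  simp only [conn]
  linarith

/-- The Gram matrix of the frame is constant, so `Γ c` lies in so(1,3); its six entries are those of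
the three graded pieces. -/
lemma Γ_decomposition (hU : IsOpen U) (hx : x ∈ U) (c : Fin 4) :
    e.Γ c x = raise (e.Γ c x 1 2) (e.Γ c x 1 3)
      + (spin (e.Γ c x 0 0) (e.Γ c x 2 3) + lower (e.Γ c x 0 2) (e.Γ c x 0 3)) := by
  have h := fun a b ↦ e.conn_skew hU hx a b c
  simp only [conn_eq] at h
  have h00 := h 0 0; have h01 := h 0 1; have h02 := h 0 2; have h03 := h 0 3
  have h11 := h 1 1; have h12 := h 1 2; have h13 := h 1 3
  have h22 := h 2 2; have h23 := h 2 3; have h33 := h 3 3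
  simp [sgn, dual] at h00 h01 h02 h03 h11 h12 h13 h22 h23 h33
  ext a b
  fin_cases a <;> fin_cases b <;> simp [raise, spin, lower] <;> linarith

/-- Real and imaginary parts: κ gives the lowering part of `Γ 0`, σ and ρ together the four lowering
entries along m₁ and m₂, and ε the boost and rotation along ℓ. -/
lemma IsKinematic.coeffs {e : NPTetrad g U} (hk : e.IsKinematic) (hU : IsOpen U) (hx : x ∈ U) :
    (∀ c, c ≠ 1 → e.Γ c x 0 2 = 0 ∧ e.Γ c x 0 3 = 0) ∧ e.Γ 0 x 0 0 = 0 ∧ e.Γ 0 x 2 3 = 0 := by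
  obtain ⟨hκ, hσ, hρ, hε⟩ := hk x hx
  have hd : ∀ c a, e.conn x a a c = 0 := fun c a ↦ by
    have := e.conn_skew hU hx a a c
    linarith
  have k1 : e.conn x 0 2 0 = 0 ∧ e.conn x 0 3 0 = 0 := by
    rw [κ, ext₃_basis _ _ 0 0 _ _ cl_apply cl_apply, cm_eq] at hκ
    simp [Fin.sum_univ_four] at hκ
    have h2 : isq * ((e.conn x 0 2 0 : ℂ) + Complex.I * e.conn x 0 3 0) = 0 := by
      linear_combination hκ
    have h3 := (mul_eq_zero.1 h2).resolve_left isq_ne_zero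
    rw [Complex.ext_iff] at h3
    simpa using h3
  have h1 : ((e.conn x 0 2 2 : ℂ) - e.conn x 0 3 3) + Complex.I * (e.conn x 0 3 2 + e.conn x 0 2 3)
      = 0 := by
    have := sum_pair_m_m (A := fun i j ↦ (e.conn x 0 i j : ℂ))
    have h : e.σ x = ∑ i, ∑ j, cm i * cm j * (e.conn x 0 i j : ℂ) := by
      simp [σ, ext₃, cl_apply]
    rw [← h, hσ] at this
    linear_combination -2 * this
  have h2 : ((e.conn x 0 2 2 : ℂ) + e.conn x 0 3 3) + Complex.I * (e.conn x 0 3 2 - e.conn x 0 2 3)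
      = 0 := by
    have := sum_pair_m_mb (A := fun i j ↦ (e.conn x 0 i j : ℂ))
    have h : e.ρ x = ∑ i, ∑ j, cm i * cmb j * (e.conn x 0 i j : ℂ) := by
      simp [ρ, ext₃, cl_apply]
    rw [← h, hρ] at this
    linear_combination -2 * this
  have h3 : (e.conn x 0 1 0 : ℂ) + Complex.I * e.conn x 2 3 0 = 0 := by
    rw [ε, ext₃_basis _ _ 0 0 _ _ cl_apply cl_apply, ext₃_m_mb _ 0 _ cl_apply] at hε
    simp [cn_apply, hd] at hε
    rw [e.conn_skew hU hx 3 2 0] at hε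
    push_cast at hε
    linear_combination hε
  rw [Complex.ext_iff] at h1 h2 h3
  simp at h1 h2 h3
  obtain ⟨a1, a2⟩ := h1
  obtain ⟨b1, b2⟩ := h2
  obtain ⟨c1, c2⟩ := h3
  obtain ⟨d1, d2⟩ := k1
  simp [conn_eq, sgn, dual] at a1 a2 b1 b2 c1 c2 d1 d2
  refine ⟨fun c hc ↦ ?_, c1, c2⟩
  fin_cases c
  · exact ⟨d1, d2⟩
  · exact absurd rfl hc
  · constructor <;> simp <;> linarith
  · constructor <;> simp <;> linarith

lemma comp_riem (x : M) (a b c d : Fin 4) : e.comp g.riem x ![a, b, c, d] = e.riemC x a b c d := by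
  simp only [comp, riemC]
  congr 1
  funext j
  fin_cases j <;> rfl

lemma curvatureLike_riemC (hU : IsOpen U) (hx : x ∈ U) : CurvatureLike (e.riemC x) where
  skew_left a b c d := by
    have h := e.curvature_skew hU hx (e.smooth_frame c) (e.smooth_frame d) (e.smooth_frame b)
      (e.smooth_frame a)
    rw [g.ip_comm] at h
    exact eq_neg_of_add_eq_zero_left h
  skew_right a b c d := by
    have h := e.curvature_swap hU hx (e.smooth_frame c) (e.smooth_frame d) (e.smooth_frame b)
    simp [riemC, LorentzianMetric.riem, LorentzianMetric.ip, h]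
  cyclic a b c d := by
    have h := e.bianchi hU hx (e.smooth_frame c) (e.smooth_frame d) (e.smooth_frame b)
    have h' := congrArg (fun v ↦ g.val x (e.frame a x) v) h
    simp only [map_add, map_zero] at h'
    simp only [riemC, LorentzianMetric.riem, LorentzianMetric.ip]
    simp
    linarith

/-- In the notation of the proof, (A - K - a - d)² + 9(b - c)² equals 36 |Ψ₂|². When it vanishes,
substituting K = A - a - d turns 4Φ₁₁² - Φ₀₂Φ₂₀ into the determinant (A - a)(A - d) - ((b + c)/2)².
-/
lemma nondegenerate_riemC (hU : IsOpen U) (hx : x ∈ U)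
    (hnd : e.Ψ₂ x ≠ 0 ∨ (e.Ψ₂ x = 0 ∧ 4 * e.Φ₁₁ x ^ 2 - e.Φ₀₂ x * e.Φ₂₀ x ≠ 0)) :
    Nondegenerate (e.riemC x) := by
  have hr := e.curvatureLike_riemC hU hx
  obtain ⟨⟨e1, e2, e3⟩, e4, e5, e6⟩ := hr.normal_forms
  have sl := hr.skew_left
  have sr := hr.skew_right
  have dl := hr.diag_left
  have dr := hr.diag_right
  have hg : ∀ a b, e.metricC x a b = if b = dual a then sgn a else 0 := e.ip_frame hx
  set A := e.riemC x 0 1 0 1 with hA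
  set K := e.riemC x 2 3 2 3 with hK
  set a := e.riemC x 0 2 1 2 with ha
  set b := e.riemC x 0 2 1 3 with hb
  set c := e.riemC x 0 3 1 2 with hc
  set d := e.riemC x 0 3 1 3 with hd
  have r01 : e.ricciC x 0 1 = - A - a - d := by
    simp only [ricciC]
    linarith [dl 0 1 1, sl 1 0 0 1, sl 2 0 2 1, sr 0 2 2 1, sl 3 0 3 1, sr 0 3 3 1]
  have r10 : e.ricciC x 1 0 = - A - a - d := by
    simp only [ricciC]
    linarith [dl 1 0 0, sr 0 1 1 0, sl 2 1 2 0, sr 1 2 2 0, sl 3 1 3 0, sr 1 3 3 0]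
  have r22 : e.ricciC x 2 2 = 2 * a - K := by
    simp only [ricciC]
    linarith [dl 2 2 2, sl 3 2 3 2, sr 2 3 3 2]
  have r33 : e.ricciC x 3 3 = 2 * d - K := by
    simp only [ricciC]
    linarith [dl 3 3 3]
  have r23 : e.ricciC x 2 3 = b + c := by
    simp only [ricciC]
    linarith [dl 2 2 3, dr 3 2 3]
  have r32 : e.ricciC x 3 2 = b + c := by
    simp only [ricciC]
    linarith [dl 3 3 2, dr 2 3 2]
  have hR : e.scalarR x = 2 * K - 2 * A - 4 * (a + d) := by
    simp only [scalarR, r01, r10, r22, r33]; ring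
  have w1 : e.weylC x 0 2 2 1 + e.weylC x 0 3 3 1 = (A - K - a - d) / 3 := by
    simp [weylC, hg, dual, sgn, r01, r22, r33, hR, sr 0 2 2 1, sr 0 3 3 1]
    ring
  have w2 : e.weylC x 0 3 2 1 - e.weylC x 0 2 3 1 = b - c := by
    simp [weylC, hg, dual, sgn, r23, r32, sr 0 2 3 1, sr 0 3 2 1]
    ring
  have hΨ : e.Ψ₂ x = -(((A - K - a - d) / 3 : ℝ) + Complex.I * ((b - c : ℝ) : ℂ)) / 2 := by
    have h := sum_pair_m_mb (A := fun i j ↦ (e.weylC x 0 i j 1 : ℂ))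
    have h' : e.Ψ₂ x = - ∑ i, ∑ j, cm i * cmb j * (e.weylC x 0 i j 1 : ℂ) := by
      simp [Ψ₂, ext₄, cl_apply, cn_apply]
    rw [h', h, ← w1, ← w2]
    push_cast
    ring
  have hS : ∀ i j, e.tracefreeRicciC x i j
      = e.ricciC x i j - e.scalarR x / 4 * if j = dual i then sgn i else 0 := fun i j ↦ by
    simp only [tracefreeRicciC, hg]
  have hΦ : 4 * e.Φ₁₁ x ^ 2 - e.Φ₀₂ x * e.Φ₂₀ x
      = (((A + K) ^ 2 - (a - d) ^ 2 - (b + c) ^ 2) / 4 : ℝ) := by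
    have h1 := sum_pair_m_mb (A := fun i j ↦ (e.tracefreeRicciC x i j : ℂ))
    have h2 := sum_pair_m_m (A := fun i j ↦ (e.tracefreeRicciC x i j : ℂ))
    have h3 := sum_pair_mb_mb (A := fun i j ↦ (e.tracefreeRicciC x i j : ℂ))
    rw [Φ₁₁, Φ₀₂, Φ₂₀, ext₂_l_n]
    simp only [ext₂]
    rw [h1, h2, h3]
    simp [hS, dual, sgn, r01, r22, r33, r23, r32, hR]
    ring_nf
    simp only [Complex.I_sq]
    ring
  have hΨ0 : e.Ψ₂ x = 0 ↔ (A - K - a - d) ^ 2 + 9 * (b - c) ^ 2 = 0 := by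
    rw [hΨ, Complex.ext_iff]
    rw [sq_add_nine_mul_sq_eq_zero]
    simp
    intro _
    rw [sub_eq_zero, sub_eq_zero, eq_comm]
  change (A - K - a - d) ^ 2 + 9 * (b - c) ^ 2 ≠ 0 ∨ ((A - K - a - d) ^ 2 + 9 * (b - c) ^ 2 = 0 ∧
    (A - a) * (A - d) - ((b + c) / 2) ^ 2 ≠ 0)
  rcases hnd with h | ⟨h, h'⟩
  · exact Or.inl (mt hΨ0.2 h)
  · have h0 := hΨ0.1 h
    refine Or.inr ⟨h0, fun h1 ↦ h' ?_⟩
    have h2 := (sq_add_nine_mul_sq_eq_zero.1 h0).1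
    rw [hΦ, Complex.ofReal_eq_zero]
    linear_combination h1 - (3 * A + K - a - d) / 4 * h2

end NPTetrad
end Kundt
end

/-! ### Reduction of the connection, the two scalar conditions, and the theorem. -/

noncomputable section
namespace Kundt

namespace NPTetrad

variable {M : Type*} [TopologicalSpace M] [ChartedSpace R4 M] [IsManifold (𝓡 4) ∞ M]
variable {g : LorentzianMetric M} {U : Set M} (e : NPTetrad g U) {x : M}

lemma curvatureLike_comp (hU : IsOpen U) (hx : x ∈ U) :
    CurvatureLike fun a b c d ↦ e.comp g.riem x ![a, b, c, d] := by
  simpa only [comp_riem] using e.curvatureLike_riemC hU hx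

/-- For c ≠ 0 and I of weight -1, the component (c, I) of ∇Riem has nonzero weight, and only the
raising part of `Γ c` contributes to it. That part therefore annihilates Riem and is zero. -/
lemma isReduced (hU : IsOpen U) (hk : e.IsKinematic) (hD0 : e.IsTypeD g.riem)
    (hD1 : e.IsTypeD (g.nabla g.riem))
    (hnd : ∀ x ∈ U, Nondegenerate fun a b c d ↦ e.comp g.riem x ![a, b, c, d]) :
    e.IsReduced := by
  have hraise : ∀ y ∈ U, ∀ c, c ≠ 0 → e.Γ c y 1 2 = 0 ∧ e.Γ c y 1 3 = 0 := by
    intro y hy c hc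
    refine raise_eq_zero (e.curvatureLike_comp hU hy) (hnd y hy) fun I hI ↦ ?_
    have h1 := e.comp_nabla hU hy (e.isTensorial_riem hU) c I
    have hc' : wt c ≠ 1 := (by decide : ∀ c : Fin 4, c ≠ 0 → wt c ≠ 1) c hc
    rw [hD1.comp_eq_zero (by rw [boostWeight_cons]; omega) hy, hD0.deriv_comp hU (by omega) hy,
      e.Γ_decomposition hU hy c, act_add_left, act_add_left,
      (hasDegree_spin _ _).act_eq_zero fun J hJ ↦ hD0.comp_eq_zero (by omega) hy,
      (hasDegree_lower _ _).act_eq_zero fun J hJ ↦ hD0.comp_eq_zero (by omega) hy] at h1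
    linarith
  have hlow : ∀ {p q : ℝ}, p = 0 ∧ q = 0 → lower p q = 0 := by
    rintro p q ⟨rfl, rfl⟩
    exact lower_zero
  have hra : ∀ {p q : ℝ}, p = 0 ∧ q = 0 → raise p q = 0 := by
    rintro p q ⟨rfl, rfl⟩
    exact raise_zero
  constructor
  · intro y hy
    obtain ⟨h1, h2, h3⟩ := hk.coeffs hU hy
    have hs : spin (e.Γ 0 y 0 0) (e.Γ 0 y 2 3) = 0 := by rw [h2, h3, spin_zero]
    have h := e.Γ_decomposition hU hy 0
    rwa [hs, hlow (h1 0 (by decide)), add_zero, add_zero] at h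
  · intro y hy
    have h := e.Γ_decomposition hU hy 1
    rwa [hra (hraise y hy 1 (by decide)), zero_add] at h
  · intro y hy
    have h := e.Γ_decomposition hU hy 2
    rwa [hra (hraise y hy 2 (by decide)), hlow ((hk.coeffs hU hy).1 2 (by decide)),
      zero_add, add_zero] at h
  · intro y hy
    have h := e.Γ_decomposition hU hy 3
    rwa [hra (hraise y hy 3 (by decide)), hlow ((hk.coeffs hU hy).1 3 (by decide)),
      zero_add, add_zero] at h

lemma D_π_eq_zero_iff (hU : IsOpen U) (hx : x ∈ U) : e.D e.π x = 0 ↔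
    deriv e.l (fun y ↦ e.Γ 0 y 1 2) x = 0 ∧ deriv e.l (fun y ↦ e.Γ 0 y 1 3) x = 0 := by
  have h1 : e.π = fun y ↦ isq * (e.Γ 0 y 1 2 : ℝ) + -(Complex.I * isq) * (e.Γ 0 y 1 3 : ℝ) := by
    funext y
    rw [π, ext₃_basis _ _ 1 0 _ _ cl_apply cn_apply, cmb_eq]
    simp [Fin.sum_univ_four, conn_eq, sgn, dual]
    ring
  rw [D, h1, deriv_ofReal_comb _ (e.Γ_smooth hU 0 1 2 x hx) (e.Γ_smooth hU 0 1 3 x hx)]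
  set u := deriv e.l (fun y ↦ e.Γ 0 y 1 2) x
  set v := deriv e.l (fun y ↦ e.Γ 0 y 1 3) x
  rw [show isq * (u : ℂ) + -(Complex.I * isq) * (v : ℂ) = isq * (u - Complex.I * v) by ring,
    mul_eq_zero, or_iff_right isq_ne_zero, Complex.ext_iff]
  simp

/-- Here τ is -(p + iq)/√2 in terms of the lowering parameters p, q of `Γ 1`, and γ - γ̄ = -iθ with
θ its rotation entry; the boost part of γ is real and drops out. -/
lemma Δ_τ_eq_zero_iff (hU : IsOpen U) (hx : x ∈ U) :
    e.Δ e.τ x - (e.γ x - (starRingEnd ℂ) (e.γ x)) * e.τ x = 0 ↔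
      deriv e.n (fun y ↦ e.Γ 1 y 0 2) x - e.Γ 1 x 2 3 * e.Γ 1 x 0 3 = 0 ∧
      deriv e.n (fun y ↦ e.Γ 1 y 0 3) x + e.Γ 1 x 2 3 * e.Γ 1 x 0 2 = 0 := by
  have h1 : e.τ = fun y ↦ -isq * (e.Γ 1 y 0 2 : ℝ) + -(Complex.I * isq) * (e.Γ 1 y 0 3 : ℝ) := by
    funext y
    rw [τ, ext₃_basis _ _ 0 1 _ _ cn_apply cl_apply, cm_eq]
    simp [Fin.sum_univ_four, conn_eq, sgn, dual]
  have hd : ∀ a, e.conn x a a 1 = 0 := fun a ↦ by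
    have := e.conn_skew hU hx a a 1
    linarith
  have h2 : e.γ x = ((e.Γ 1 x 0 0 : ℝ) - Complex.I * (e.Γ 1 x 2 3 : ℝ)) / 2 := by
    rw [γ, ext₃_basis _ _ 0 1 _ _ cn_apply cl_apply, ext₃_m_mb _ 1 _ cn_apply, hd, hd,
      e.conn_skew hU hx 3 2]
    simp [cn_apply, conn_eq, sgn, dual]
    ring
  have h3 : e.γ x - (starRingEnd ℂ) (e.γ x) = - Complex.I * (e.Γ 1 x 2 3 : ℝ) := by
    have h4 : (starRingEnd ℂ) 2 = 2 := Complex.conj_ofNat 2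
    rw [h2]
    simp [h4]
    ring
  rw [Δ, h3, h1, deriv_ofReal_comb _ (e.Γ_smooth hU 1 0 2 x hx) (e.Γ_smooth hU 1 0 3 x hx)]
  set u := deriv e.n (fun y ↦ e.Γ 1 y 0 2) x
  set v := deriv e.n (fun y ↦ e.Γ 1 y 0 3) x
  set p := e.Γ 1 x 0 2
  set q := e.Γ 1 x 0 3
  set θ := e.Γ 1 x 2 3
  rw [show -isq * (u : ℂ) + -(Complex.I * isq) * (v : ℂ) - -Complex.I * (θ : ℂ) *
    (-isq * (p : ℂ) + -(Complex.I * isq) * (q : ℂ))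
    = -isq * ((u - θ * q : ℝ) + Complex.I * (v + θ * p : ℝ)) by
      push_cast
      linear_combination (-(isq * θ * q)) * Complex.I_sq,
    mul_eq_zero, or_iff_right (neg_ne_zero.2 isq_ne_zero), Complex.ext_iff]
  simp

end NPTetrad

end Kundt
end

theorem theorem5p1 {M : Type*} [TopologicalSpace M] [ChartedSpace Kundt.R4 M]
    [IsManifold (𝓡 4) ∞ M] (g : Kundt.LorentzianMetric M) (U : Set M) (hU : IsOpen U)
    (e : Kundt.NPTetrad g U) (hkin : e.IsKinematic)
    (hD0 : e.IsTypeD (g.nablaRiem 0)) (hD1 : e.IsTypeD (g.nablaRiem 1))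
    (hnd : ∀ x ∈ U, e.Ψ₂ x ≠ 0 ∨
      (e.Ψ₂ x = 0 ∧ 4 * e.Φ₁₁ x ^ 2 - e.Φ₀₂ x * e.Φ₂₀ x ≠ 0)) :
    (∀ n : ℕ, 2 ≤ n → e.IsTypeD (g.nablaRiem n)) ↔
      (∀ x ∈ U, e.D e.π x = 0 ∧
        e.Δ e.τ x - (e.γ x - (starRingEnd ℂ) (e.γ x)) * e.τ x = 0) := by
  have hnd' : ∀ x ∈ U, Kundt.Nondegenerate fun a b c d ↦ e.comp g.riem x ![a, b, c, d] := by
    intro x hx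
    simpa only [Kundt.NPTetrad.comp_riem] using e.nondegenerate_riemC hU hx (hnd x hx)
  have hred := e.isReduced hU hkin hD0 hD1 hnd'
  have hT := e.isTensorial_riem hU
  constructor
  · intro h x hx
    have h2 : e.IsTypeD (g.nabla (g.nabla g.riem)) := h 2 le_rfl
    rw [e.D_π_eq_zero_iff hU hx, e.Δ_τ_eq_zero_iff hU hx]
    constructor
    · refine Kundt.raise_eq_zero (e.curvatureLike_comp hU hx) (hnd' x hx) fun I hI ↦ ?_
      have h3 := hred.comp_zero_zero hU hT hD0 hD1 hx hI
      rw [h2.comp_eq_zero (by simp [Kundt.boostWeight_cons, Kundt.wt, hI]) hx] at h3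
      linarith
    · refine Kundt.lower_eq_zero (e.curvatureLike_comp hU hx) (hnd' x hx) fun I hI ↦ ?_
      have h3 := hred.comp_one_one hU hT hD0 hD1 hx hI
      rw [h2.comp_eq_zero (by simp [Kundt.boostWeight_cons, Kundt.wt, hI]) hx] at h3
      linarith
  · intro h
    -- The step from T to ∇∇T needs both T and ∇T type D, so the induction carries two consecutive
    -- orders.
    have key : ∀ n : ℕ, e.IsTypeD (g.nablaRiem n) ∧ e.IsTypeD (g.nablaRiem (n + 1)) := by
      intro n
      induction n with
      | zero => exact ⟨hD0, hD1⟩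
      | succ n ih =>
        have hTn := e.isTensorial_nablaRiem hU n
        refine ⟨ih.2, hred.isTypeD_nabla_nabla hU hD0 hTn ih.1 ih.2 ?_ ?_⟩
        · intro x hx I hI
          obtain ⟨hp, hq⟩ := (e.D_π_eq_zero_iff hU hx).1 (h x hx).1
          have h3 := hred.comp_zero_zero hU hTn ih.1 ih.2 hx hI
          rw [hp, hq, Kundt.raise_zero] at h3
          rw [h3]
          simp [Kundt.act]
        · intro x hx I hI
          obtain ⟨hp, hq⟩ := (e.Δ_τ_eq_zero_iff hU hx).1 (h x hx).2
          have h3 := hred.comp_one_one hU hTn ih.1 ih.2 hx hI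
          rw [hp, hq, Kundt.lower_zero] at h3
          rw [h3]
          simp [Kundt.act]
    exact fun n _ ↦ (key n).1
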